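/- Let $n,k,r$ be integers with $3\le r\le n$ and $k\ge 2$. Let $\Gamma_{n,k}$ be the disjoint union of $n$ copies of the complete graph $K_k$, with vertices $(i,j)$, $1\le i\le n$, $1\le j\le k$, where $(i,j)$ is the $j$-th vertex of the $i$-th copy. Let $\mathcal I^r_{n,k}$ be the collection of all independent sets of size $r$ in $\Gamma_{n,k}$. Two families of vertex sets are called isomorphic if some automorphism of $\Gamma_{n,k}$ maps one onto the other. For $r<n$ put $H=\{(2,1),(3,1),\dots,(r+1,1)\}$ and $$\mathcal H^r_{n,k}=\{X\in\mathcal I^r_{n,k} : (1,1)\in X,\ X\cap H\ne\emptyset\}\cup\{H\}.$$ Put $L=\{(2,1),(3,1),\dots,(n,1)\}$ and $$\mathcal L_{n,k}=\{X\in\mathcal I^n_{n,k} : (1,1)\in X,\ X\cap L\neq\emptyset\}\cup\big\{\{(1,i)\}\cup L : 2\le i\le k\big\}.$$ Let $\mathcal F\subseteq\mathcal I^r_{n,k}$ be a family in which any two sets intersect and such that no vertex lies in every set of $\mathcal F$. Then: 1. If $r<n$, then $|\mathcal F|\le|\mathcal H^r_{n,k}|$. Moreover, if $r\ge4$, then $|\mathcal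 F|=|\mathcal H^r_{n,k}|$ if and only if $\mathcal F$ is isomorphic to $\mathcal H^r_{n,k}$. 2. If $r=n$, then $|\mathcal F|\le k^{n-1}-(k-1)^{n-1}+k-1$. Moreover, if $n\ge5$, then equality holds whenever $\mathcal F$ is isomorphic to $\mathcal L_{n,k}$; and if $n\ge 5$ and $k\ge3$, then equality holds only if $\mathcal F$ is isomorphic to $\mathcal L_{n,k}$. -/

import Mathlib

/-- The disjoint union of `n` copies of the complete graph on `k` vertices. The vertex `(i, j)`
is the `j`-th vertex of the `i`-th copy. Labels are counted from `0` here, so the vertex that is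
written `(i, j)` with labels counted from `1` is `(i - 1, j - 1)`. -/
def cliqueUnion (n k : ℕ) : SimpleGraph (Fin n × Fin k) where
  Adj v w := v.1 = w.1 ∧ v.2 ≠ w.2
  symm := ⟨fun _ _ h => ⟨h.1.symm, h.2.symm⟩⟩
  loopless := ⟨fun _ h => h.2 rfl⟩

instance (n k : ℕ) : DecidableRel (cliqueUnion n k).Adj := fun v w =>
  inferInstanceAs (Decidable (v.1 = w.1 ∧ v.2 ≠ w.2))

/-- The collection of all independent sets of size `r` in `cliqueUnion n k`. -/
def rIndepSets (n k r : ℕ) : Finset (Finset (Fin n × Fin k)) :=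
  Finset.univ.filter fun X => (cliqueUnion n k).IsNIndepSet r X

/-- The `r`-independent sets containing the first vertex of the first copy. -/
def ekrFamily (n k r : ℕ) : Finset (Finset (Fin n × Fin k)) :=
  (rIndepSets n k r).filter fun X => ∃ v ∈ X, v.1.val = 0 ∧ v.2.val = 0

/-- The set `[2, r + 1] × {1}` of first vertices of the copies number `2, …, r + 1`
(number `1, …, r` when counted from `0`). -/
def firstVertices (n k r : ℕ) : Finset (Fin n × Fin k) :=
  Finset.univ.filter fun v => (1 ≤ v.1.val ∧ v.1.val ≤ r) ∧ v.2.val = 0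

/-- The Hilton–Milner family, meant for `r < n`: the set `H = [2, r + 1] × {1}` together with all
`r`-independent sets that contain the vertex `(1, 1)` and meet `H`. -/
def hmFamily (n k r : ℕ) : Finset (Finset (Fin n × Fin k)) :=
  ((ekrFamily n k r).filter fun X => (X ∩ firstVertices n k r).Nonempty) ∪ {firstVertices n k r}

/-- The extremal family for `r = n`: all `n`-independent sets that contain `(1, 1)` and meet
`L = [2, n] × {1}`, together with the sets `{(1, i)} ∪ L` for `i ≥ 2`. -/
def fullFamily (n k : ℕ) : Finset (Finset (Fin n × Fin k)) :=
  ((ekrFamily n k n).filter fun X => (X ∩ firstVertices n k (n - 1)).Nonempty) ∪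
    (Finset.univ.filter fun i : Fin k => 1 ≤ i.val).image fun i =>
      (Finset.univ.filter fun v : Fin n × Fin k => v.1.val = 0 ∧ v.2 = i) ∪
        firstVertices n k (n - 1)

/-- Two families of vertex sets of `cliqueUnion n k` are isomorphic if an automorphism of the
graph (a relabelling of the copies, and of the vertices within each copy) takes one to the
other. -/
def FamilyIso {n k : ℕ} (F G : Finset (Finset (Fin n × Fin k))) : Prop :=
  ∃ σ : cliqueUnion n k ≃g cliqueUnion n k, F.image (fun X => X.image σ) = G

/-!
# Nontrivial intersecting families of independent sets in a disjoint union of cliques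

Fix a label `o`. Replacing a label `j` by `o` in one clique, wherever this creates a new set, is a
shift: it preserves the size of a family and the intersection property. If all of these shifts
leave an intersecting family `F` unchanged, any two of its members meet in a vertex labelled `o`
(`trace_inter_trace_nonempty`), so the traces `{i | (i, o) ∈ X}` form an intersecting family `G` of
sets of cliques, nontrivial if `F` is. The number of independent sets with a given trace depends
only on the size `s` of the trace and does not increase with `s`, so `F` is bounded by a weighted
sum of the numbers `g s` of members of `G` of size `s`. Let `n` be the number of cliques. For
`2 * s ≤ n` the Hilton–Milner theorem bounds `g s` (if the sets of size `s` have a common point, a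
member of `G` avoiding this point does), and complementation bounds `g s + g (n - s)` by
`n.choose s`; as the weights do not increase, these bounds give the weight of the extremal family
(`sum_mul_le_sum_mul`, `sum_weight_nontriv_le`).

A shift may destroy nontriviality. Then every member of `F` contains one of the two vertices of the
shift, and the links at these vertices are nonempty and cross-intersecting. Their total size is
bounded in the same way, by Hilton's bound for cross-intersecting families of sets in place of the
Hilton–Milner theorem (`CrossIntersecting.card_add_card_le_indSets`). Both theorems on uniform
families of sets are proved by shifting and induction on the size of the ground set.

For uniqueness, equality forces at least four traces of size two. Pairwise intersecting, they form
a star, and this determines the family of traces (`exists_subset_extTraces`). Finally a family with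
an extremal shift is itself extremal (`exists_eq_extremal_of_shift`): a family of the right size is
extremal as soon as enough of its members contain a common vertex (`eq_extremal_of_card_le`). The
number of members through the centre can be lower before the shift only if this is a shift to the
centre itself, and then the links at the two vertices of the shift cannot both be proper parts of
the extremal link. For `r < n` this follows from the bound on cross-intersecting families; for
`r = n` and at least three labels it holds because the transversals meeting a fixed transversal, other
than that one, are connected under disjointness.
-/

/-! ### Shifting families of finite sets -/

section Shifting

variable {α : Type*} [DecidableEq α]

/-- Two families of finite sets are cross-intersecting if every member of the first meets every
member of the second. A family is intersecting if it is cross-intersecting with itself. -/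
def CrossIntersecting (A B : Finset (Finset α)) : Prop :=
  ∀ a ∈ A, ∀ b ∈ B, (a ∩ b).Nonempty

/-- A family of finite sets is nontrivial if no point lies in all of its members. In particular
it is nonempty as soon as there is a point. -/
def Nontriv (A : Finset (Finset α)) : Prop :=
  ∀ v, ∃ a ∈ A, v ∉ a

/-- The shift that replaces `y` by `x` in every member of the family that contains `y` but not `x`,
unless the resulting set is in the family already. -/
def shift (x y : α) (A : Finset (Finset α)) : Finset (Finset α) :=
  UV.compression {x} {y} A

/-- The total weight of a family, each point `z` of each member being counted with weight `φ z`. -/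
def totalWeight (φ : α → ℕ) (A : Finset (Finset α)) : ℕ :=
  ∑ a ∈ A, ∑ z ∈ a, φ z

lemma CrossIntersecting.symm {A B : Finset (Finset α)} (h : CrossIntersecting A B) :
    CrossIntersecting B A := fun b hb a ha => by
  rw [Finset.inter_comm]; exact h a ha b hb

lemma CrossIntersecting.mono {A B A' B' : Finset (Finset α)} (h : CrossIntersecting A B)
    (hA : A' ⊆ A) (hB : B' ⊆ B) : CrossIntersecting A' B' :=
  fun a ha b hb => h a (hA ha) b (hB hb)

lemma compress_singleton {x y : α} (hxy : x ≠ y) (a : Finset α) :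
    UV.compress {x} {y} a = if x ∉ a ∧ y ∈ a then insert x (a.erase y) else a := by
  unfold UV.compress
  simp only [Finset.disjoint_singleton_left, Finset.singleton_subset_iff]
  split_ifs with h
  · ext z
    simp only [Finset.sup_eq_union, Finset.mem_sdiff, Finset.mem_union, Finset.mem_singleton,
      Finset.mem_insert, Finset.mem_erase]
    constructor
    · rintro ⟨h1 | h1, h2⟩
      · exact Or.inr ⟨h2, h1⟩
      · exact Or.inl h1
    · rintro (rfl | h1)
      · exact ⟨Or.inr rfl, hxy⟩
      · exact ⟨Or.inl h1.2, h1.1⟩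
  · rfl

lemma mem_shift {x y : α} (hxy : x ≠ y) {A : Finset (Finset α)} {a : Finset α} :
    a ∈ shift x y A ↔ (a ∈ A ∧ (y ∈ a → x ∉ a → insert x (a.erase y) ∈ A)) ∨
      (a ∉ A ∧ x ∈ a ∧ y ∉ a ∧ insert y (a.erase x) ∈ A) := by
  unfold shift
  rw [UV.mem_compression]
  refine or_congr (and_congr_right fun ha => ?_) (and_congr_right fun ha => ?_)
  · rw [compress_singleton hxy]
    split_ifs with h
    · exact ⟨fun h' _ _ => h', fun h' => h' h.2 h.1⟩
    · exact ⟨fun _ h1 h2 => absurd ⟨h2, h1⟩ h, fun _ => ha⟩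
  · constructor
    · rintro ⟨b, hb, rfl⟩
      rw [compress_singleton hxy] at ha ⊢
      split_ifs at ha ⊢ with h
      · refine ⟨Finset.mem_insert_self _ _, by simp [hxy.symm], ?_⟩
        rw [Finset.erase_insert (by simp [h.1]), Finset.insert_erase h.2]
        exact hb
      · exact absurd hb ha
    · rintro ⟨hx, hy, h⟩
      refine ⟨_, h, ?_⟩
      rw [compress_singleton hxy, if_pos (by simp [hxy]), Finset.erase_insert (by simp [hy]),
        Finset.insert_erase hx]

lemma card_shift (x y : α) (A : Finset (Finset α)) : (shift x y A).card = A.card :=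
  UV.card_compression _ _ _

lemma card_insert_erase {x y : α} {a : Finset α} (hx : x ∉ a) (hy : y ∈ a) :
    (insert x (a.erase y)).card = a.card := by
  rw [Finset.card_insert_of_notMem (by simp [hx]), Finset.card_erase_add_one hy]

lemma mem_of_shift_eq {x y : α} (hxy : x ≠ y) {A : Finset (Finset α)} (h : shift x y A = A)
    {a : Finset α} (ha : a ∈ A) (hy : y ∈ a) (hx : x ∉ a) : insert x (a.erase y) ∈ A := by
  have h1 := ha
  rw [← h, mem_shift hxy] at h1
  rcases h1 with h1 | h1
  · exact h1.2 hy hx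
  · exact absurd ha h1.1

lemma crossIntersecting_shift {x y : α} (hxy : x ≠ y) {A B : Finset (Finset α)}
    (h : CrossIntersecting A B) : CrossIntersecting (shift x y A) (shift x y B) := by
  -- the case in which exactly one of the two sets has been moved
  have key : ∀ {A B : Finset (Finset α)}, CrossIntersecting A B → ∀ a b : Finset α,
      b ∈ B → (y ∈ b → x ∉ b → insert x (b.erase y) ∈ B) → x ∈ a → y ∉ a →
      insert y (a.erase x) ∈ A → (a ∩ b).Nonempty := by
    intro A B h a b hb hb' hxa hya haA
    by_cases hxb : x ∈ b
    · exact ⟨x, Finset.mem_inter.2 ⟨hxa, hxb⟩⟩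
    by_cases hyb : y ∈ b
    · obtain ⟨z, hz⟩ := h _ haA _ (hb' hyb hxb)
      refine ⟨z, ?_⟩
      simp only [Finset.mem_inter, Finset.mem_insert, Finset.mem_erase] at hz ⊢
      grind
    · obtain ⟨z, hz⟩ := h _ haA _ hb
      refine ⟨z, ?_⟩
      simp only [Finset.mem_inter, Finset.mem_insert, Finset.mem_erase] at hz ⊢
      grind
  intro a ha b hb
  rw [mem_shift hxy] at ha hb
  rcases ha with ⟨ha, ha'⟩ | ⟨_, hxa, hya, haA⟩ <;> rcases hb with ⟨hb, hb'⟩ | ⟨_, hxb, hyb, hbB⟩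
  · exact h a ha b hb
  · rw [Finset.inter_comm]; exact key h.symm b a ha ha' hxb hyb hbB
  · exact key h a b hb hb' hxa hya haA
  · exact ⟨x, Finset.mem_inter.2 ⟨hxa, hxb⟩⟩

lemma totalWeight_shift_lt {x y : α} {φ : α → ℕ} (hφ : φ x < φ y) {A : Finset (Finset α)}
    (h : shift x y A ≠ A) : totalWeight φ (shift x y A) < totalWeight φ A := by
  have hxy : x ≠ y := by rintro rfl; exact lt_irrefl _ hφ
  have hlt : ∀ a ∈ A.filter (fun a => UV.compress {x} {y} a ∉ A),
      ∑ z ∈ UV.compress {x} {y} a, φ z < ∑ z ∈ a, φ z := by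
    intro a ha
    rw [Finset.mem_filter, compress_singleton hxy] at ha
    rw [compress_singleton hxy]
    split_ifs at ha ⊢ with h'
    · rw [Finset.sum_insert (by simp [h'.1]), ← Finset.add_sum_erase _ _ h'.2]
      omega
    · exact absurd ha.1 ha.2
  have hne : (A.filter (fun a => UV.compress {x} {y} a ∉ A)).Nonempty := by
    by_contra hne
    rw [Finset.not_nonempty_iff_eq_empty, Finset.filter_eq_empty_iff] at hne
    apply h
    refine (Finset.eq_of_subset_of_card_le (fun a ha => ?_) (card_shift x y A).le).symm
    exact UV.mem_compression.2 (Or.inl ⟨ha, not_not.1 (hne ha)⟩)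
  unfold totalWeight shift
  rw [UV.compression, Finset.sum_union UV.compress_disjoint, Finset.filter_image,
    Finset.sum_image UV.compress_injOn,
    ← Finset.sum_filter_add_sum_filter_not A (fun a => UV.compress {x} {y} a ∈ A)]
  exact Nat.add_lt_add_left (Finset.sum_lt_sum_of_nonempty hne hlt) _

/-- If a shift turns a nontrivial family into a trivial one, then every member of the family
contains one of the two points of the shift. -/
lemma mem_or_mem_of_not_nontriv_shift {x y : α} (hxy : x ≠ y) {A : Finset (Finset α)}
    (hA : Nontriv A) (h : ¬ Nontriv (shift x y A)) : ∀ a ∈ A, x ∈ a ∨ y ∈ a := by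
  unfold Nontriv at h
  push Not at h
  obtain ⟨v, hv⟩ := h
  have hold : ∀ a ∈ A, (y ∈ a → x ∉ a → insert x (a.erase y) ∈ A) → v ∈ a := fun a ha h' =>
    hv a ((mem_shift hxy).2 (Or.inl ⟨ha, h'⟩))
  have hvx : v = x := by
    by_contra hvx
    obtain ⟨a, ha, hva⟩ := hA v
    by_cases h' : y ∈ a → x ∉ a → insert x (a.erase y) ∈ A
    · exact hva (hold a ha h')
    · push Not at h'
      have := hv (insert x (a.erase y)) ((mem_shift hxy).2 (Or.inr ⟨h'.2.2, by simp,
        by simp [hxy.symm], by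
          rwa [Finset.erase_insert (by simp [h'.2.1]), Finset.insert_erase h'.1]⟩))
      simp only [Finset.mem_insert, Finset.mem_erase, hvx, false_or] at this
      exact hva this.2
  subst hvx
  intro a ha
  by_contra hcon
  push Not at hcon
  exact hcon.1 (hold a ha fun h1 => absurd h1 hcon.2)

/-- Links at two distinct points, of the members containing just one of them, inherit the
cross-intersection property. -/
lemma CrossIntersecting.links {A : Finset (Finset α)} (h : CrossIntersecting A A) {x y : α}
    (hxy : x ≠ y) :
    CrossIntersecting ((A.memberSubfamily x).nonMemberSubfamily y)
      ((A.nonMemberSubfamily x).memberSubfamily y) := by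
  intro a ha b hb
  simp only [Finset.mem_nonMemberSubfamily, Finset.mem_memberSubfamily, Finset.mem_insert,
    not_or] at ha hb
  obtain ⟨z, hz⟩ := h _ ha.1.1 _ hb.1.1
  refine ⟨z, ?_⟩
  simp only [Finset.mem_inter, Finset.mem_insert] at hz ⊢
  grind

end Shifting

/-! ### Uniform families -/

section Uniform

variable {α : Type*} [DecidableEq α]

lemma card_add_card_powersetCard_sdiff_le {V b : Finset α} {s : ℕ} {A : Finset (Finset α)}
    (hA : A ⊆ V.powersetCard s) (hb : b ⊆ V) (h : ∀ a ∈ A, (a ∩ b).Nonempty) :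
    A.card + (V.card - b.card).choose s ≤ V.card.choose s := by
  rw [← Finset.card_sdiff_of_subset hb, ← Finset.card_powersetCard s (V \ b),
    ← Finset.card_powersetCard s V, ← Finset.card_union_of_disjoint]
  · exact Finset.card_le_card (Finset.union_subset hA
      (Finset.powersetCard_mono Finset.sdiff_subset))
  · rw [Finset.disjoint_left]
    intro a ha ha'
    obtain ⟨z, hz⟩ := h a ha
    rw [Finset.mem_inter] at hz
    exact (Finset.mem_sdiff.1 ((Finset.mem_powersetCard.1 ha').1 hz.1)).2 hz.2

/-- An `s`-uniform family whose members all contain `x` and meet a set `b` avoiding `x`. -/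
lemma card_star_add_le {V b : Finset α} {s : ℕ} {A : Finset (Finset α)} {x : α}
    (hA : A ⊆ V.powersetCard s) (hb : b ⊆ V) (hxb : x ∉ b) (hx : ∀ a ∈ A, x ∈ a)
    (h : ∀ a ∈ A, (a ∩ b).Nonempty) :
    A.card + (V.card - 1 - b.card).choose (s - 1) ≤ (V.card - 1).choose (s - 1) := by
  rcases A.eq_empty_or_nonempty with rfl | ⟨a0, ha0⟩
  · simpa using Nat.choose_le_choose _ (Nat.sub_le _ _)
  have hxV : x ∈ V := (Finset.mem_powersetCard.1 (hA ha0)).1 (hx a0 ha0)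
  have hcard : (A.image fun a => a.erase x).card = A.card := by
    refine Finset.card_image_of_injOn fun a ha b hb hab => ?_
    have := congrArg (insert x) hab
    simpa [Finset.insert_erase (hx a ha), Finset.insert_erase (hx b hb)] using this
  rw [← hcard, ← Finset.card_erase_of_mem hxV]
  refine card_add_card_powersetCard_sdiff_le ?_
    (fun z hz => Finset.mem_erase.2 ⟨by rintro rfl; exact hxb hz, hb hz⟩) ?_
  · intro c hc
    obtain ⟨a, ha, rfl⟩ := Finset.mem_image.1 hc
    have := Finset.mem_powersetCard.1 (hA ha)
    exact Finset.mem_powersetCard.2 ⟨Finset.erase_subset_erase _ this.1, by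
      rw [Finset.card_erase_of_mem (hx a ha), this.2]⟩
  · intro c hc
    obtain ⟨a, ha, rfl⟩ := Finset.mem_image.1 hc
    obtain ⟨z, hz⟩ := h a ha
    rw [Finset.mem_inter] at hz
    exact ⟨z, Finset.mem_inter.2 ⟨Finset.mem_erase.2 ⟨by rintro rfl; exact hxb hz.2, hz.1⟩, hz.2⟩⟩

/-- A set and its complement do not belong to cross-intersecting families. -/
lemma CrossIntersecting.card_add_card_le {V : Finset α} {s : ℕ} {A B : Finset (Finset α)}
    (h : CrossIntersecting A B) (hs : s ≤ V.card) (hA : A ⊆ V.powersetCard s)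
    (hB : B ⊆ V.powersetCard (V.card - s)) : A.card + B.card ≤ V.card.choose s := by
  have hcard : (B.image fun b => V \ b).card = B.card := by
    refine Finset.card_image_of_injOn fun a ha b hb hab => ?_
    have h1 := (Finset.mem_powersetCard.1 (hB ha)).1
    have h2 := (Finset.mem_powersetCard.1 (hB hb)).1
    have := congrArg (fun c => V \ c) hab
    simpa [Finset.inter_eq_right.2 h1, Finset.inter_eq_right.2 h2] using this
  rw [← hcard, ← Finset.card_powersetCard s V, ← Finset.card_union_of_disjoint]
  · refine Finset.card_le_card (Finset.union_subset hA fun c hc => ?_)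
    obtain ⟨b, hb, rfl⟩ := Finset.mem_image.1 hc
    have := Finset.mem_powersetCard.1 (hB hb)
    refine Finset.mem_powersetCard.2 ⟨Finset.sdiff_subset, ?_⟩
    rw [Finset.card_sdiff_of_subset this.1, this.2]
    omega
  · rw [Finset.disjoint_left]
    intro a ha ha'
    obtain ⟨b, hb, rfl⟩ := Finset.mem_image.1 ha'
    obtain ⟨z, hz⟩ := h _ ha _ hb
    simp at hz

lemma memberSubfamily_subset_powersetCard {V : Finset α} {s : ℕ} {A : Finset (Finset α)} {x : α}
    (hA : A ⊆ V.powersetCard s) : A.memberSubfamily x ⊆ (V.erase x).powersetCard (s - 1) := by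
  intro a ha
  rw [Finset.mem_memberSubfamily] at ha
  have := Finset.mem_powersetCard.1 (hA ha.1)
  rw [Finset.card_insert_of_notMem ha.2] at this
  refine Finset.mem_powersetCard.2 ⟨fun z hz => Finset.mem_erase.2
    ⟨by rintro rfl; exact ha.2 hz, this.1 (Finset.mem_insert_of_mem hz)⟩, by omega⟩

lemma nonMemberSubfamily_subset_powersetCard {V : Finset α} {s : ℕ} {A : Finset (Finset α)} {x : α}
    (hA : A ⊆ V.powersetCard s) : A.nonMemberSubfamily x ⊆ (V.erase x).powersetCard s := by
  intro a ha
  rw [Finset.mem_nonMemberSubfamily] at ha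
  have := Finset.mem_powersetCard.1 (hA ha.1)
  exact Finset.mem_powersetCard.2 ⟨fun z hz => Finset.mem_erase.2
    ⟨by rintro rfl; exact ha.2 hz, this.1 hz⟩, this.2⟩

lemma shift_subset_powersetCard {V : Finset α} {s : ℕ} {A : Finset (Finset α)} {x y : α}
    (hxy : x ≠ y) (hx : x ∈ V) (hA : A ⊆ V.powersetCard s) : shift x y A ⊆ V.powersetCard s := by
  intro a ha
  rw [mem_shift hxy] at ha
  rcases ha with ha | ⟨_, hxa, hya, ha⟩
  · exact hA ha.1
  · have := Finset.mem_powersetCard.1 (hA ha)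
    rw [card_insert_erase hya hxa] at this
    refine Finset.mem_powersetCard.2 ⟨fun z hz => ?_, this.2⟩
    by_cases hzx : z = x
    · rwa [hzx]
    · exact this.1 (by simp [hzx, hz])

end Uniform

/-! ### Hilton's bound for cross-intersecting families -/

section UniformBounds

lemma totalWeight_shift_le {α : Type*} [DecidableEq α] {x y : α} {φ : α → ℕ} (hφ : φ x < φ y)
    (A : Finset (Finset α)) : totalWeight φ (shift x y A) ≤ totalWeight φ A := by
  by_cases h : shift x y A = A
  · rw [h]
  · exact (totalWeight_shift_lt hφ h).le

lemma exists_lt_notMem {m : ℕ} {c : Finset ℕ} (hc : c.card < m) : ∃ i < m, i ∉ c := by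
  by_contra hcon
  push Not at hcon
  have := Finset.card_le_card (s := Finset.range m) (t := c) fun i hi =>
    hcon i (Finset.mem_range.1 hi)
  rw [Finset.card_range] at this
  omega

lemma card_union_lt {m s : ℕ} (hm : 2 * s ≤ m) {a b : Finset ℕ}
    (ha : (insert m a).card = s) (hma : m ∉ a) (hb : (insert m b).card = s) (hmb : m ∉ b) :
    (a ∪ b).card < m := by
  have := Finset.card_union_le a b
  rw [Finset.card_insert_of_notMem hma] at ha
  rw [Finset.card_insert_of_notMem hmb] at hb
  omega

/-- In shifted families the links at the last point are cross-intersecting, because two members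
through that point leave some smaller point uncovered, to which it can be moved in one of them. -/
lemma CrossIntersecting.memberSubfamily_of_shifted {m s : ℕ} (hm : 2 * s ≤ m)
    {A B : Finset (Finset ℕ)} (h : CrossIntersecting A B)
    (hA : A ⊆ (Finset.range (m + 1)).powersetCard s)
    (hB : B ⊆ (Finset.range (m + 1)).powersetCard s)
    (hsh : ∀ i j, i < j → j < m + 1 → shift i j A = A) :
    CrossIntersecting (A.memberSubfamily m) (B.memberSubfamily m) := by
  intro a ha b hb
  rw [Finset.mem_memberSubfamily] at ha hb
  obtain ⟨i, him, hi⟩ := exists_lt_notMem (card_union_lt hm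
    (Finset.mem_powersetCard.1 (hA ha.1)).2 ha.2 (Finset.mem_powersetCard.1 (hB hb.1)).2 hb.2)
  rw [Finset.mem_union, not_or] at hi
  have := mem_of_shift_eq him.ne (hsh i m him (Nat.lt_succ_self m)) ha.1
    (Finset.mem_insert_self _ _) (by simp [him.ne, hi.1])
  rw [Finset.erase_insert ha.2] at this
  obtain ⟨z, hz⟩ := h _ this _ hb.1
  refine ⟨z, ?_⟩
  simp only [Finset.mem_inter, Finset.mem_insert] at hz ⊢
  grind

lemma range_succ_erase (m : ℕ) : (Finset.range (m + 1)).erase m = Finset.range m := by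
  rw [Finset.range_add_one, Finset.erase_insert (by simp)]

lemma nonMemberSubfamily_nonempty_of_shifted {m s : ℕ} (hm : 2 * s ≤ m)
    {A : Finset (Finset ℕ)} (hne : A.Nonempty) (hs : 1 ≤ s)
    (hA : A ⊆ (Finset.range (m + 1)).powersetCard s)
    (hsh : ∀ i j, i < j → j < m + 1 → shift i j A = A) : (A.nonMemberSubfamily m).Nonempty := by
  obtain ⟨a, ha⟩ := hne
  by_cases hma : m ∈ a
  · obtain ⟨i, him, hi⟩ := exists_lt_notMem (m := m) (c := a) (by
      have := (Finset.mem_powersetCard.1 (hA ha)).2; omega)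
    exact ⟨_, Finset.mem_nonMemberSubfamily.2
      ⟨mem_of_shift_eq him.ne (hsh i m him (Nat.lt_succ_self m)) ha hma hi, by simp [him.ne']⟩⟩
  · exact ⟨a, Finset.mem_nonMemberSubfamily.2 ⟨ha, hma⟩⟩

/-- Hilton's bound for two nonempty cross-intersecting families of `s`-subsets of `range m`. -/
theorem CrossIntersecting.card_add_card_add_choose_le_range (m : ℕ) :
    ∀ (s : ℕ) (A B : Finset (Finset ℕ)), 2 * s ≤ m → A ⊆ (Finset.range m).powersetCard s →
      B ⊆ (Finset.range m).powersetCard s → A.Nonempty → B.Nonempty → CrossIntersecting A B →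
      A.card + B.card + (m - s).choose s ≤ m.choose s + 1 := by
  induction m with
  | zero =>
    intro s A B hs hA hB hAne hBne h
    obtain ⟨a, ha⟩ := hAne
    obtain ⟨b, hb⟩ := hBne
    obtain ⟨z, hz⟩ := h a ha b hb
    have := (Finset.mem_powersetCard.1 (hA ha)).1 (Finset.mem_inter.1 hz).1
    simp at this
  | succ m ih =>
    intro s
    -- induction on the total weight reduces the claim to shifted families
    suffices H : ∀ (N : ℕ) (A B : Finset (Finset ℕ)), totalWeight id A + totalWeight id B = N →
        2 * s ≤ m + 1 → A ⊆ (Finset.range (m + 1)).powersetCard s →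
        B ⊆ (Finset.range (m + 1)).powersetCard s → A.Nonempty → B.Nonempty →
        CrossIntersecting A B →
        A.card + B.card + (m + 1 - s).choose s ≤ (m + 1).choose s + 1 from
      fun A B => H _ A B rfl
    intro N
    induction N using Nat.strong_induction_on with
    | _ N ihN =>
    intro A B hN hs hA hB hAne hBne h
    have hs1 : 1 ≤ s := by
      by_contra hs0
      obtain ⟨a, ha⟩ := hAne
      obtain ⟨b, hb⟩ := hBne
      obtain ⟨z, hz⟩ := h a ha b hb
      have h1 := Finset.card_pos.2 ⟨z, (Finset.mem_inter.1 hz).1⟩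
      have h2 := (Finset.mem_powersetCard.1 (hA ha)).2
      omega
    rcases Nat.lt_or_ge m (2 * s) with hms | hms
    · have hms' : m + 1 = 2 * s := by omega
      have := h.card_add_card_le (V := Finset.range (m + 1)) (s := s) (by simp; omega) hA (by
        rwa [Finset.card_range, show m + 1 - s = s by omega])
      rw [Finset.card_range] at this
      rw [show m + 1 - s = s by omega, Nat.choose_self]
      omega
    by_cases hsh : ∀ i j, i < j → j < m + 1 → shift i j A = A ∧ shift i j B = B
    · have hshA := fun i j hij hj => (hsh i j hij hj).1
      have hshB := fun i j hij hj => (hsh i j hij hj).2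
      have hA0 := nonMemberSubfamily_nonempty_of_shifted hms hAne hs1 hA hshA
      have hB0 := nonMemberSubfamily_nonempty_of_shifted hms hBne hs1 hB hshB
      have sA0 := nonMemberSubfamily_subset_powersetCard (x := m) hA
      have sB0 := nonMemberSubfamily_subset_powersetCard (x := m) hB
      have sA1 := memberSubfamily_subset_powersetCard (x := m) hA
      have sB1 := memberSubfamily_subset_powersetCard (x := m) hB
      rw [range_succ_erase] at sA0 sB0 sA1 sB1
      have h0 := ih s _ _ hms sA0 sB0 hA0 hB0
        (h.mono (Finset.filter_subset _ _) (Finset.filter_subset _ _))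
      have hcross := h.memberSubfamily_of_shifted hms hA hB hshA
      -- if one of the links is empty, the other one meets a fixed `s`-set
      have hone : ∀ {A B : Finset (Finset ℕ)}, CrossIntersecting A B →
          A.memberSubfamily m ⊆ (Finset.range m).powersetCard (s - 1) →
          B.nonMemberSubfamily m ⊆ (Finset.range m).powersetCard s →
          (B.nonMemberSubfamily m).Nonempty →
          (A.memberSubfamily m).card + (m - s).choose (s - 1) ≤ m.choose (s - 1) := by
        intro A B h sA1 sB0 hB0
        obtain ⟨b, hb⟩ := hB0
        have hb' := Finset.mem_powersetCard.1 (sB0 hb)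
        have := card_add_card_powersetCard_sdiff_le sA1 hb'.1 fun a ha => by
          rw [Finset.mem_memberSubfamily] at ha
          rw [Finset.mem_nonMemberSubfamily] at hb
          obtain ⟨z, hz⟩ := h _ ha.1 _ hb.1
          refine ⟨z, ?_⟩
          simp only [Finset.mem_inter, Finset.mem_insert] at hz ⊢
          grind
        rwa [Finset.card_range, hb'.2] at this
      have h1 : (A.memberSubfamily m).card + (B.memberSubfamily m).card
          + (m - s).choose (s - 1) ≤ m.choose (s - 1) := by
        rcases (A.memberSubfamily m).eq_empty_or_nonempty with hA1 | hA1
        · rw [hA1, Finset.card_empty, zero_add]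
          exact hone h.symm sB1 sA0 hA0
        rcases (B.memberSubfamily m).eq_empty_or_nonempty with hB1 | hB1
        · rw [hB1, Finset.card_empty, add_zero]
          exact hone h sA1 sB0 hB0
        have hs2 : 2 ≤ s := by
          by_contra hs2
          obtain ⟨a, ha⟩ := hA1
          obtain ⟨b, hb⟩ := hB1
          obtain ⟨z, hz⟩ := hcross a ha b hb
          have h1 := Finset.card_pos.2 ⟨z, (Finset.mem_inter.1 hz).1⟩
          have h2 := (Finset.mem_powersetCard.1 (sA1 ha)).2
          omega
        have := ih (s - 1) _ _ (by omega) sA1 sB1 hA1 hB1 hcross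
        obtain ⟨t, rfl⟩ : ∃ t, s = t + 2 := ⟨s - 2, by omega⟩
        have hp := Nat.choose_succ_succ (m - (t + 2)) t
        have hpos : 0 < (m - (t + 2)).choose t := Nat.choose_pos (by omega)
        rw [show m - (t + 2 - 1) = m - (t + 2) + 1 by omega] at this
        simp only [Nat.add_succ_sub_one, Nat.succ_eq_add_one] at *
        omega
      obtain ⟨t, rfl⟩ : ∃ t, s = t + 1 := ⟨s - 1, by omega⟩
      have hp1 := Nat.choose_succ_succ m t
      have hp2 := Nat.choose_succ_succ (m - (t + 1)) t
      rw [show m + 1 - (t + 1) = m - (t + 1) + 1 by omega]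
      have cA := Finset.card_memberSubfamily_add_card_nonMemberSubfamily m A
      have cB := Finset.card_memberSubfamily_add_card_nonMemberSubfamily m B
      simp only [Nat.add_succ_sub_one, Nat.succ_eq_add_one, add_zero] at *
      omega
    · push Not at hsh
      obtain ⟨i, j, hij, hj, hne⟩ := hsh
      have hw : totalWeight id (shift i j A) + totalWeight id (shift i j B) < N := by
        have hAle := totalWeight_shift_le (φ := id) hij A
        have hBle := totalWeight_shift_le (φ := id) hij B
        by_cases hA' : shift i j A = A
        · have := totalWeight_shift_lt (φ := id) hij (hne hA')
          omega
        · have := totalWeight_shift_lt (φ := id) hij hA'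
          omega
      have := ihN _ hw (shift i j A) (shift i j B) rfl hs
        (shift_subset_powersetCard hij.ne (Finset.mem_range.2 (by omega)) hA)
        (shift_subset_powersetCard hij.ne (Finset.mem_range.2 (by omega)) hB)
        (by rw [← Finset.card_pos, card_shift]; exact hAne.card_pos)
        (by rw [← Finset.card_pos, card_shift]; exact hBne.card_pos)
        (crossIntersecting_shift hij.ne h)
      rwa [card_shift, card_shift] at this

/-- Every finite set is in bijection with an initial segment of `ℕ`. -/
lemma exists_injOn_image_eq_range {α : Type*} [DecidableEq α] (V : Finset α) :
    ∃ f : α → ℕ, Set.InjOn f V ∧ V.image f = Finset.range V.card := by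
  classical
  refine ⟨fun x => if h : x ∈ V then V.equivFin ⟨x, h⟩ else 0, ?_, ?_⟩
  · intro x hx y hy hxy
    rw [Finset.mem_coe] at hx hy
    simpa [hx, hy, Fin.val_inj] using hxy
  · ext i
    simp only [Finset.mem_image, Finset.mem_range]
    constructor
    · rintro ⟨x, hx, rfl⟩
      simp [hx]
    · intro hi
      refine ⟨V.equivFin.symm ⟨i, hi⟩, (V.equivFin.symm ⟨i, hi⟩).2, ?_⟩
      simp

lemma image_subset_powersetCard {α β : Type*} [DecidableEq α] [DecidableEq β] {V : Finset α}
    {s : ℕ} {A : Finset (Finset α)} {f : α → β} (hf : Set.InjOn f V) (hA : A ⊆ V.powersetCard s) :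
    A.image (fun a => a.image f) ⊆ (V.image f).powersetCard s ∧
      (A.image fun a => a.image f).card = A.card := by
  constructor
  · intro c hc
    obtain ⟨a, ha, rfl⟩ := Finset.mem_image.1 hc
    have := Finset.mem_powersetCard.1 (hA ha)
    exact Finset.mem_powersetCard.2 ⟨Finset.image_subset_image this.1, by
      rw [Finset.card_image_of_injOn (hf.mono (Finset.coe_subset.2 this.1)), this.2]⟩
  · refine Finset.card_image_of_injOn fun a ha b hb hab => ?_
    have h1 := (Finset.mem_powersetCard.1 (hA ha)).1
    have h2 := (Finset.mem_powersetCard.1 (hA hb)).1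
    have hab' : a.image f = b.image f := hab
    apply Finset.coe_injective
    exact hf.image_eq_image_iff (Finset.coe_subset.2 h1) (Finset.coe_subset.2 h2) |>.1 (by
      rw [← Finset.coe_image, ← Finset.coe_image, hab'])

lemma CrossIntersecting.image {α β : Type*} [DecidableEq α] [DecidableEq β]
    {A B : Finset (Finset α)} (h : CrossIntersecting A B) (f : α → β) :
    CrossIntersecting (A.image fun a => a.image f) (B.image fun a => a.image f) := by
  intro c hc d hd
  obtain ⟨a, ha, rfl⟩ := Finset.mem_image.1 hc
  obtain ⟨b, hb, rfl⟩ := Finset.mem_image.1 hd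
  obtain ⟨z, hz⟩ := h a ha b hb
  rw [Finset.mem_inter] at hz
  exact ⟨f z, Finset.mem_inter.2
    ⟨Finset.mem_image_of_mem f hz.1, Finset.mem_image_of_mem f hz.2⟩⟩

/-- Hilton's bound for two nonempty cross-intersecting families of `s`-subsets of a finite set. -/
theorem CrossIntersecting.card_add_card_add_choose_le {α : Type*} [DecidableEq α] {V : Finset α}
    {s : ℕ} {A B : Finset (Finset α)} (h : CrossIntersecting A B) (hs : 2 * s ≤ V.card)
    (hA : A ⊆ V.powersetCard s) (hB : B ⊆ V.powersetCard s) (hAne : A.Nonempty)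
    (hBne : B.Nonempty) :
    A.card + B.card + (V.card - s).choose s ≤ V.card.choose s + 1 := by
  obtain ⟨f, hf, hV⟩ := exists_injOn_image_eq_range V
  have hA' := image_subset_powersetCard hf hA
  have hB' := image_subset_powersetCard hf hB
  rw [← hA'.2, ← hB'.2]
  exact card_add_card_add_choose_le_range _ s _ _ hs (hV ▸ hA'.1) (hV ▸ hB'.1) (hAne.image _)
    (hBne.image _) (h.image f)

end UniformBounds

/-! ### The Hilton–Milner theorem -/

section HiltonMilner

lemma two_le_of_nontriv {α : Type*} [DecidableEq α] {V : Finset α} {s : ℕ}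
    {A : Finset (Finset α)} (hA : A ⊆ V.powersetCard s) (h : CrossIntersecting A A)
    (hnt : Nontriv A) (hne : A.Nonempty) : 2 ≤ s := by
  obtain ⟨a, ha⟩ := hne
  obtain ⟨x, hx⟩ := h a ha a ha
  obtain ⟨b, hb, hxb⟩ := hnt x
  obtain ⟨z, hz⟩ := h a ha b hb
  rw [Finset.mem_inter] at hx hz
  have hzx : z ≠ x := by rintro rfl; exact hxb hz.2
  have := (Finset.one_lt_card).2 ⟨z, hz.1, x, hx.1, hzx⟩
  rw [(Finset.mem_powersetCard.1 (hA ha)).2] at this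
  exact this

/-- An intersecting family each member of which contains `x` or `y`: the members containing just
one of these points have cross-intersecting links. -/
lemma card_add_choose_le_of_mem_or_mem {α : Type*} [DecidableEq α] {V : Finset α} {s : ℕ}
    {A : Finset (Finset α)} {x y : α} (hxy : x ≠ y) (hx : x ∈ V) (hy : y ∈ V) (hs2 : 2 ≤ s)
    (hs : 2 * s ≤ V.card) (hA : A ⊆ V.powersetCard s) (h : CrossIntersecting A A)
    (hnt : Nontriv A) (hmem : ∀ a ∈ A, x ∈ a ∨ y ∈ a) :
    A.card + (V.card - 1 - s).choose (s - 1) ≤ (V.card - 1).choose (s - 1) + 1 := by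
  have hV : ((V.erase x).erase y).card = V.card - 2 := by
    rw [Finset.card_erase_of_mem (Finset.mem_erase.2 ⟨hxy.symm, hy⟩), Finset.card_erase_of_mem hx]
    omega
  have s1 := nonMemberSubfamily_subset_powersetCard (x := y)
    (memberSubfamily_subset_powersetCard (x := x) hA)
  have s2 := memberSubfamily_subset_powersetCard (x := y)
    (nonMemberSubfamily_subset_powersetCard (x := x) hA)
  have s3 := memberSubfamily_subset_powersetCard (x := y)
    (memberSubfamily_subset_powersetCard (x := x) hA)
  have c1 := Finset.card_memberSubfamily_add_card_nonMemberSubfamily x A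
  have c2 := Finset.card_memberSubfamily_add_card_nonMemberSubfamily y (A.memberSubfamily x)
  have c3 := Finset.card_memberSubfamily_add_card_nonMemberSubfamily y (A.nonMemberSubfamily x)
  have c4 : (A.nonMemberSubfamily x).nonMemberSubfamily y = ∅ := by
    refine Finset.eq_empty_of_forall_notMem fun a ha => ?_
    simp only [Finset.mem_nonMemberSubfamily] at ha
    rcases hmem a ha.1.1 with h' | h'
    · exact ha.1.2 h'
    · exact ha.2 h'
  rw [c4, Finset.card_empty] at c3
  have n1 : ((A.memberSubfamily x).nonMemberSubfamily y).Nonempty := by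
    obtain ⟨a, ha, hya⟩ := hnt y
    have hxa := (hmem a ha).resolve_right hya
    refine ⟨a.erase x, ?_⟩
    simp only [Finset.mem_nonMemberSubfamily, Finset.mem_memberSubfamily, Finset.insert_erase hxa]
    simp [ha, hya]
  have n2 : ((A.nonMemberSubfamily x).memberSubfamily y).Nonempty := by
    obtain ⟨a, ha, hxa⟩ := hnt x
    have hya := (hmem a ha).resolve_left hxa
    refine ⟨a.erase y, ?_⟩
    simp only [Finset.mem_nonMemberSubfamily, Finset.mem_memberSubfamily, Finset.insert_erase hya]
    simp [ha, hxa]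
  have hb := (h.links hxy).card_add_card_add_choose_le (by rw [hV]; omega) s1 s2 n1 n2
  have hc := Finset.card_le_card s3
  rw [Finset.card_powersetCard] at hc
  rw [hV] at hb hc
  obtain ⟨t, rfl⟩ : ∃ t, s = t + 2 := ⟨s - 2, by omega⟩
  obtain ⟨m, hm⟩ : ∃ m, V.card = m + 2 := ⟨V.card - 2, by omega⟩
  rw [hm] at hb hc ⊢
  have hp := Nat.choose_succ_succ m t
  rw [show m + 2 - 2 - (t + 2 - 1) = m + 2 - 1 - (t + 2) by omega] at hb
  simp only [Nat.add_succ_sub_one, Nat.succ_eq_add_one, Nat.add_sub_cancel, add_zero] at *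
  omega

/-- The Hilton–Milner theorem for subsets of `range n`. -/
theorem card_add_choose_le_of_nontriv_range (n : ℕ) :
    ∀ (s : ℕ) (A : Finset (Finset ℕ)), 2 * s ≤ n → A ⊆ (Finset.range n).powersetCard s →
      CrossIntersecting A A → Nontriv A →
      A.card + (n - 1 - s).choose (s - 1) ≤ (n - 1).choose (s - 1) + 1 := by
  induction n with
  | zero =>
    intro s A hs hA h hnt
    obtain ⟨a, ha, -⟩ := hnt 0
    have := two_le_of_nontriv hA h hnt ⟨a, ha⟩
    omega
  | succ n ih =>
    intro s
    suffices H : ∀ (N : ℕ) (A : Finset (Finset ℕ)), totalWeight id A = N →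
        2 * s ≤ n + 1 → A ⊆ (Finset.range (n + 1)).powersetCard s →
        CrossIntersecting A A → Nontriv A →
        A.card + (n + 1 - 1 - s).choose (s - 1) ≤ (n + 1 - 1).choose (s - 1) + 1 from
      fun A => H _ A rfl
    intro N
    induction N using Nat.strong_induction_on with
    | _ N ihN =>
    intro A hN hs hA h hnt
    have hAne : A.Nonempty := (hnt 0).imp fun a ha => ha.1
    have hs2 := two_le_of_nontriv hA h hnt hAne
    by_cases hsh : ∀ i j, i < j → j < n + 1 → shift i j A = A
    swap
    · push Not at hsh
      obtain ⟨i, j, hij, hj, hne⟩ := hsh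
      by_cases hnt' : Nontriv (shift i j A)
      · have hw := totalWeight_shift_lt (φ := id) hij hne
        have := ihN _ (hN ▸ hw) (shift i j A) rfl hs
          (shift_subset_powersetCard hij.ne (Finset.mem_range.2 (by omega)) hA)
          (crossIntersecting_shift hij.ne h) hnt'
        rwa [card_shift] at this
      · have := card_add_choose_le_of_mem_or_mem hij.ne (Finset.mem_range.2 (by omega))
          (Finset.mem_range.2 hj) hs2 (by simpa using hs) hA h hnt
          (mem_or_mem_of_not_nontriv_shift hij.ne hnt hnt')
        rwa [Finset.card_range] at this
    rcases Nat.lt_or_ge n (2 * s) with hns | hns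
    · have hns' : n + 1 = 2 * s := by omega
      have := h.card_add_card_le (V := Finset.range (n + 1)) (s := s) (by simp; omega) hA (by
        rwa [Finset.card_range, show n + 1 - s = s by omega])
      rw [Finset.card_range] at this
      obtain ⟨t, rfl⟩ : ∃ t, s = t + 1 := ⟨s - 1, by omega⟩
      obtain rfl : n = 2 * t + 1 := by omega
      have hp := Nat.choose_succ_succ (2 * t + 1) t
      have hsym : (2 * t + 1).choose (t + 1) = (2 * t + 1).choose t :=
        Nat.choose_symm_of_eq_add (by omega)
      rw [show 2 * t + 1 + 1 - 1 - (t + 1) = t by omega]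
      simp only [Nat.succ_eq_add_one, Nat.add_sub_cancel, Nat.choose_self] at *
      omega
    have sA0 := nonMemberSubfamily_subset_powersetCard (x := n) hA
    have sA1 := memberSubfamily_subset_powersetCard (x := n) hA
    rw [range_succ_erase] at sA0 sA1
    have hnt0 : Nontriv (A.nonMemberSubfamily n) := by
      intro x
      obtain ⟨a, ha, hxa⟩ := hnt x
      by_cases hna : n ∈ a
      · -- one point of `a` is `n` itself, so that `a ∪ {x}` leaves a smaller point free
        obtain ⟨i, hin, hi⟩ := exists_lt_notMem (m := n) (c := insert x a) (by
          have h1 := (Finset.mem_powersetCard.1 (hA ha)).2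
          have h2 := Finset.card_insert_le x a
          omega)
        rw [Finset.mem_insert, not_or] at hi
        refine ⟨_, Finset.mem_nonMemberSubfamily.2 ⟨mem_of_shift_eq hin.ne
          (hsh i n hin (Nat.lt_succ_self n)) ha hna hi.2, by simp [hin.ne']⟩, ?_⟩
        simp [Ne.symm hi.1, hxa]
      · exact ⟨a, Finset.mem_nonMemberSubfamily.2 ⟨ha, hna⟩, hxa⟩
    have h0 := ih s _ hns sA0 (h.mono (Finset.filter_subset _ _) (Finset.filter_subset _ _)) hnt0
    have hcross := h.memberSubfamily_of_shifted hns hA hA hsh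
    have h1 : (A.memberSubfamily n).card + (n - 1 - s).choose (s - 1 - 1)
        ≤ (n - 1).choose (s - 1 - 1) := by
      by_cases hnt1 : Nontriv (A.memberSubfamily n)
      · have hne1 : (A.memberSubfamily n).Nonempty := (hnt1 0).imp fun a ha => ha.1
        have hs3 := two_le_of_nontriv sA1 hcross hnt1 hne1
        have := ih (s - 1) _ (by omega) sA1 hcross hnt1
        obtain ⟨t, rfl⟩ : ∃ t, s = t + 3 := ⟨s - 3, by omega⟩
        have hp := Nat.choose_succ_succ (n - 1 - (t + 3)) t
        have hpos : 0 < (n - 1 - (t + 3)).choose t := Nat.choose_pos (by omega)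
        rw [show n - 1 - (t + 3 - 1) = n - 1 - (t + 3) + 1 by omega] at this
        simp only [Nat.add_succ_sub_one, Nat.succ_eq_add_one] at *
        omega
      · unfold Nontriv at hnt1
        push Not at hnt1
        obtain ⟨x, hx⟩ := hnt1
        obtain ⟨b, hb, hxb⟩ := hnt0 x
        have hb' := Finset.mem_powersetCard.1 (sA0 hb)
        have := card_star_add_le sA1 hb'.1 hxb hx fun a ha => by
          rw [Finset.mem_memberSubfamily] at ha
          rw [Finset.mem_nonMemberSubfamily] at hb
          obtain ⟨z, hz⟩ := h _ ha.1 _ hb.1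
          refine ⟨z, ?_⟩
          simp only [Finset.mem_inter, Finset.mem_insert] at hz ⊢
          grind
        rwa [Finset.card_range, hb'.2] at this
    obtain ⟨t, rfl⟩ : ∃ t, s = t + 2 := ⟨s - 2, by omega⟩
    obtain ⟨m, rfl⟩ : ∃ m, n = m + 1 := ⟨n - 1, by omega⟩
    have hp1 := Nat.choose_succ_succ m t
    have hp2 := Nat.choose_succ_succ (m - (t + 2)) t
    have cA := Finset.card_memberSubfamily_add_card_nonMemberSubfamily (m + 1) A
    rw [show m + 1 + 1 - 1 - (t + 2) = m - (t + 2) + 1 by omega]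
    simp only [Nat.add_succ_sub_one, Nat.succ_eq_add_one, Nat.add_sub_cancel] at *
    omega

/-- The Hilton–Milner theorem for subsets of a finite set. -/
theorem card_add_choose_le_of_nontriv {α : Type*} [DecidableEq α] {V : Finset α}
    {s : ℕ} {A : Finset (Finset α)} (h : CrossIntersecting A A) (hs : 2 * s ≤ V.card)
    (hA : A ⊆ V.powersetCard s) (hnt : Nontriv A) (hne : A.Nonempty) :
    A.card + (V.card - 1 - s).choose (s - 1) ≤ (V.card - 1).choose (s - 1) + 1 := by
  obtain ⟨f, hf, hV⟩ := exists_injOn_image_eq_range V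
  have hA' := image_subset_powersetCard hf hA
  rw [← hA'.2]
  refine card_add_choose_le_of_nontriv_range _ s _ hs (hV ▸ hA'.1) (h.image f) fun i => ?_
  by_cases hi : i ∈ V.image f
  · obtain ⟨x, hx, rfl⟩ := Finset.mem_image.1 hi
    obtain ⟨a, ha, hxa⟩ := hnt x
    refine ⟨_, Finset.mem_image_of_mem _ ha, fun hcon => ?_⟩
    obtain ⟨z, hz, hzx⟩ := Finset.mem_image.1 hcon
    rw [hf ((Finset.mem_powersetCard.1 (hA ha)).1 hz) hx hzx] at hz
    exact hxa hz
  · obtain ⟨a, ha⟩ := hne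
    refine ⟨_, Finset.mem_image_of_mem _ ha, fun hcon => hi ?_⟩
    exact Finset.image_subset_image (Finset.mem_powersetCard.1 (hA ha)).1 hcon

end HiltonMilner

/-! ### Independent sets of a disjoint union of cliques and their traces -/

section Traces

variable {ι κ : Type*} [Fintype ι] [DecidableEq ι] [Fintype κ] [DecidableEq κ]

/-- The independent sets of size `r` in the disjoint union of the cliques `{i} × κ` with `i ∈ V`:
sets of `r` pairs whose first components are distinct and lie in `V`. -/
def indSets (V : Finset ι) (r : ℕ) : Finset (Finset (ι × κ)) :=
  Finset.univ.filter fun X =>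
    X.card = r ∧ (∀ p ∈ X, p.1 ∈ V) ∧ ∀ p ∈ X, ∀ q ∈ X, p.1 = q.1 → p = q

/-- The set of cliques in which `X` uses the vertex labelled `o`. -/
def trace (o : κ) (X : Finset (ι × κ)) : Finset ι :=
  Finset.univ.filter fun i => (i, o) ∈ X

/-- The number of independent sets of size `r` in `N` cliques of size `k` that have a prescribed
trace of size `t`. -/
def traceWeight (N r k t : ℕ) : ℕ :=
  if t ≤ r then (N - t).choose (r - t) * (k - 1) ^ (r - t) else 0

lemma mem_indSets {V : Finset ι} {r : ℕ} {X : Finset (ι × κ)} :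
    X ∈ indSets V r ↔
      X.card = r ∧ (∀ p ∈ X, p.1 ∈ V) ∧ ∀ p ∈ X, ∀ q ∈ X, p.1 = q.1 → p = q := by
  simp [indSets]

omit [Fintype κ] in
@[simp] lemma mem_trace {o : κ} {X : Finset (ι × κ)} {i : ι} : i ∈ trace o X ↔ (i, o) ∈ X := by
  simp [trace]

lemma eq_label_of_mem {V : Finset ι} {r : ℕ} {X : Finset (ι × κ)} (hX : X ∈ indSets V r)
    {i : ι} {j l : κ} (hj : (i, j) ∈ X) (hl : (i, l) ∈ X) : j = l :=
  congrArg Prod.snd ((mem_indSets.1 hX).2.2 _ hj _ hl rfl)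

lemma trace_subset {o : κ} {V : Finset ι} {r : ℕ} {X : Finset (ι × κ)} (hX : X ∈ indSets V r) :
    trace o X ⊆ V := fun _ hi => (mem_indSets.1 hX).2.1 _ (mem_trace.1 hi)

lemma card_image_fst {V : Finset ι} {r : ℕ} {X : Finset (ι × κ)} (hX : X ∈ indSets V r) :
    (X.image Prod.fst).card = r := by
  rw [Finset.card_image_of_injOn, (mem_indSets.1 hX).1]
  exact fun p hp q hq h => (mem_indSets.1 hX).2.2 p hp q hq h

lemma card_trace_le {o : κ} {V : Finset ι} {r : ℕ} {X : Finset (ι × κ)} (hX : X ∈ indSets V r) :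
    (trace o X).card ≤ r := by
  rw [← card_image_fst hX]
  exact Finset.card_le_card fun i hi => Finset.mem_image.2 ⟨(i, o), mem_trace.1 hi, rfl⟩

/-- Counting independent sets all of whose labels lie in `L`. -/
lemma card_indSets_labels (o : κ) (V : Finset ι) (r : ℕ) (L : Finset κ) :
    ((indSets V r).filter fun X => ∀ p ∈ X, p.2 ∈ L).card = V.card.choose r * L.card ^ r := by
  rw [Finset.card_eq_sum_card_fiberwise (f := fun X => X.image Prod.fst)
    (t := V.powersetCard r), ← Finset.card_powersetCard r V, ← smul_eq_mul, ← Finset.sum_const]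
  · refine Finset.sum_congr rfl fun S hS => ?_
    obtain ⟨hSV, hSr⟩ := Finset.mem_powersetCard.1 hS
    -- an independent set with support `S` is the graph of a function on `S`
    have hpi : (Fintype.piFinset fun i => if i ∈ S then L else {o}).card = L.card ^ r := by
      rw [Fintype.card_piFinset, ← hSr, ← Finset.prod_const]
      symm
      refine Finset.prod_subset_one_on_sdiff (Finset.subset_univ S) (fun i hi => ?_)
        fun i hi => ?_
      · rw [if_neg (Finset.mem_sdiff.1 hi).2, Finset.card_singleton]
      · rw [if_pos hi]
    rw [← hpi]
    symm
    refine Finset.card_bij (fun f _ => S.image fun i => (i, f i)) ?_ ?_ ?_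
    · intro f hf
      rw [Fintype.mem_piFinset] at hf
      simp only [Finset.mem_filter, mem_indSets]
      refine ⟨⟨⟨?_, ?_, ?_⟩, ?_⟩, ?_⟩
      · rw [Finset.card_image_of_injective, hSr]
        exact fun i j h => congrArg Prod.fst h
      · intro p hp
        obtain ⟨i, hi, rfl⟩ := Finset.mem_image.1 hp
        exact hSV hi
      · intro p hp q hq h
        obtain ⟨i, hi, rfl⟩ := Finset.mem_image.1 hp
        obtain ⟨j, hj, rfl⟩ := Finset.mem_image.1 hq
        obtain rfl : i = j := h
        rfl
      · intro p hp
        obtain ⟨i, hi, rfl⟩ := Finset.mem_image.1 hp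
        have := hf i
        rwa [if_pos hi] at this
      · rw [Finset.image_image]
        exact Finset.image_id
    · intro f hf g hg hfg
      rw [Fintype.mem_piFinset] at hf hg
      funext i
      by_cases hi : i ∈ S
      · have : (i, f i) ∈ S.image fun i => (i, g i) := by
          rw [← hfg]; exact Finset.mem_image_of_mem _ hi
        obtain ⟨j, _, hj⟩ := Finset.mem_image.1 this
        rw [Prod.mk.injEq] at hj
        obtain ⟨rfl, hj⟩ := hj
        exact hj.symm
      · have h1 := hf i
        have h2 := hg i
        rw [if_neg hi, Finset.mem_singleton] at h1 h2
        rw [h1, h2]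
    · intro X hX
      simp only [Finset.mem_filter] at hX
      obtain ⟨⟨hX, hL⟩, hXS⟩ := hX
      have hlab : ∀ i ∈ S, ∃ l, (i, l) ∈ X := by
        intro i hi
        rw [← hXS] at hi
        obtain ⟨p, hp, rfl⟩ := Finset.mem_image.1 hi
        exact ⟨p.2, hp⟩
      have : Nonempty κ := ⟨o⟩
      choose! g hg using hlab
      refine ⟨fun i => if i ∈ S then g i else o, ?_, ?_⟩
      · rw [Fintype.mem_piFinset]
        intro i
        by_cases hi : i ∈ S
        · simp only [if_pos hi]
          exact hL _ (hg i hi)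
        · simp [if_neg hi]
      · ext p
        simp only [Finset.mem_image]
        constructor
        · rintro ⟨i, hi, rfl⟩
          rw [if_pos hi]
          exact hg i hi
        · intro hp
          have hpS : p.1 ∈ S := by
            rw [← hXS]; exact Finset.mem_image_of_mem _ hp
          refine ⟨p.1, hpS, ?_⟩
          rw [if_pos hpS]
          exact (mem_indSets.1 hX).2.2 _ (hg _ hpS) _ hp rfl
  · intro X hX
    rw [Finset.mem_coe, Finset.mem_filter] at hX
    refine Finset.mem_coe.2 (Finset.mem_powersetCard.2 ⟨?_, card_image_fst hX.1⟩)
    intro i hi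
    obtain ⟨p, hp, rfl⟩ := Finset.mem_image.1 hi
    exact (mem_indSets.1 hX.1).2.1 p hp

/-- The number of independent sets with a given trace. -/
lemma card_filter_trace_eq (o : κ) {V T : Finset ι} (hT : T ⊆ V) (r : ℕ) :
    ((indSets V r).filter fun X : Finset (ι × κ) => trace o X = T).card =
      traceWeight V.card r (Fintype.card κ) T.card := by
  unfold traceWeight
  split_ifs with htr
  swap
  · rw [Finset.card_eq_zero, Finset.filter_eq_empty_iff]
    rintro X hX rfl
    exact htr (card_trace_le hX)
  have hcard := card_indSets_labels o (V \ T) (r - T.card) ({o}ᶜ : Finset κ)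
  rw [Finset.card_sdiff_of_subset hT, Finset.card_compl, Finset.card_singleton] at hcard
  rw [← hcard]
  have hTo : (T.image fun i => (i, o)).card = T.card :=
    Finset.card_image_of_injective _ fun i j h => congrArg Prod.fst h
  have hsplit : ∀ X : Finset (ι × κ), trace o X = T →
      (T.image fun i => (i, o)) = X.filter fun p => p.2 = o := by
    rintro X rfl
    ext ⟨i, l⟩
    simp only [Finset.mem_image, mem_trace, Prod.mk.injEq, Finset.mem_filter]
    constructor
    · rintro ⟨j, hj, rfl, rfl⟩
      exact ⟨hj, rfl⟩
    · rintro ⟨h, rfl⟩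
      exact ⟨i, h, rfl, rfl⟩
  refine Finset.card_bij (fun X _ => X.filter fun p => p.2 ≠ o) ?_ ?_ ?_
  · intro X hX
    obtain ⟨hX, hXT⟩ := Finset.mem_filter.1 hX
    have hX' := mem_indSets.1 hX
    simp only [Finset.mem_filter, mem_indSets]
    refine ⟨⟨?_, ?_, ?_⟩, ?_⟩
    · have : T.card + (X.filter fun p => p.2 ≠ o).card = r := by
        rw [← hTo, hsplit X hXT, ← hX'.1]
        exact Finset.card_filter_add_card_filter_not _
      omega
    · rintro ⟨i, l⟩ ⟨hp, hpo⟩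
      refine Finset.mem_sdiff.2 ⟨hX'.2.1 _ hp, fun hi => hpo ?_⟩
      rw [← hXT, mem_trace] at hi
      exact eq_label_of_mem hX hp hi
    · intro p hp q hq h
      exact hX'.2.2 p hp.1 q hq.1 h
    · intro p hp
      simpa using hp.2
  · intro X hX Y hY h
    rw [← Finset.filter_union_filter_not_eq (fun p => p.2 = o) X,
      ← Finset.filter_union_filter_not_eq (fun p => p.2 = o) Y,
      ← hsplit X (Finset.mem_filter.1 hX).2, ← hsplit Y (Finset.mem_filter.1 hY).2]
    exact congrArg _ h
  · intro Y hY
    obtain ⟨hY, hYo⟩ := Finset.mem_filter.1 hY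
    have hY' := mem_indSets.1 hY
    have hYo' : ∀ i, (i, o) ∉ Y := fun i hi => by simpa using hYo _ hi
    refine ⟨(T.image fun i => (i, o)) ∪ Y, ?_, ?_⟩
    · rw [Finset.mem_filter, mem_indSets]
      refine ⟨⟨?_, ?_, ?_⟩, ?_⟩
      · rw [Finset.card_union_of_disjoint, hTo, hY'.1]
        · omega
        · rw [Finset.disjoint_left]
          intro p hp hpY
          obtain ⟨i, _, rfl⟩ := Finset.mem_image.1 hp
          exact hYo' i hpY
      · intro p hp
        rcases Finset.mem_union.1 hp with hp | hp
        · obtain ⟨i, hi, rfl⟩ := Finset.mem_image.1 hp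
          exact hT hi
        · exact (Finset.mem_sdiff.1 (hY'.2.1 p hp)).1
      · intro p hp q hq h
        rcases Finset.mem_union.1 hp with hp | hp <;> rcases Finset.mem_union.1 hq with hq | hq
        · obtain ⟨i, hi, rfl⟩ := Finset.mem_image.1 hp
          obtain ⟨j, hj, rfl⟩ := Finset.mem_image.1 hq
          obtain rfl : i = j := h
          rfl
        · obtain ⟨i, hi, rfl⟩ := Finset.mem_image.1 hp
          have h' : i = q.1 := h
          exact absurd (h' ▸ hi) (Finset.mem_sdiff.1 (hY'.2.1 q hq)).2
        · obtain ⟨j, hj, rfl⟩ := Finset.mem_image.1 hq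
          have h' : p.1 = j := h
          exact absurd (h' ▸ hj) (Finset.mem_sdiff.1 (hY'.2.1 p hp)).2
        · exact hY'.2.2 p hp q hq h
      · ext i
        simp [hYo']
    · ext ⟨i, l⟩
      simp only [Finset.mem_filter, Finset.mem_union, Finset.mem_image, Prod.mk.injEq]
      constructor
      · rintro ⟨⟨j, _, _, rfl⟩ | h, hl⟩
        · exact absurd rfl hl
        · exact h
      · intro h
        exact ⟨Or.inr h, by rintro rfl; exact hYo' _ h⟩

lemma card_filter_trace_mem (o : κ) {V : Finset ι} {G : Finset (Finset ι)} (hG : G ⊆ V.powerset)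
    (r : ℕ) :
    ((indSets V r).filter fun X : Finset (ι × κ) => trace o X ∈ G).card =
      ∑ s ∈ Finset.range (V.card + 1),
        traceWeight V.card r (Fintype.card κ) s * (G.filter fun T => T.card = s).card := by
  have hmaps : Set.MapsTo (trace o)
      ((indSets V r).filter fun X : Finset (ι × κ) => trace o X ∈ G : Set (Finset (ι × κ))) G :=
    fun X hX => (Finset.mem_filter.1 hX).2
  rw [Finset.card_eq_sum_card_fiberwise hmaps]
  have : ∀ T ∈ G, (((indSets V r).filter fun X : Finset (ι × κ) => trace o X ∈ G).filter
      fun X => trace o X = T).card = traceWeight V.card r (Fintype.card κ) T.card := by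
    intro T hT
    rw [← card_filter_trace_eq o (Finset.mem_powerset.1 (hG hT)), Finset.filter_filter]
    congr 1
    refine Finset.filter_congr fun X _ => ?_
    constructor
    · exact fun h => h.2
    · rintro rfl; exact ⟨hT, rfl⟩
  rw [Finset.sum_congr rfl this, ← Finset.sum_fiberwise_of_maps_to (g := Finset.card)
    (t := Finset.range (V.card + 1))]
  · refine Finset.sum_congr rfl fun s _ => ?_
    rw [Finset.sum_congr rfl (g := fun _ => traceWeight V.card r (Fintype.card κ) s),
      Finset.sum_const, smul_eq_mul, mul_comm]
    intro T hT
    rw [(Finset.mem_filter.1 hT).2]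
  · intro T hT
    exact Finset.mem_range.2 (Nat.lt_succ_of_le (Finset.card_le_card
      (Finset.mem_powerset.1 (hG hT))))

lemma shift_subset_indSets {o j : κ} {i : ι} (hj : j ≠ o) {V : Finset ι} {r : ℕ}
    {P : Finset (Finset (ι × κ))} (hP : P ⊆ indSets V r) :
    shift (i, o) (i, j) P ⊆ indSets V r := by
  have hne : ((i, o) : ι × κ) ≠ (i, j) := fun h => hj (congrArg Prod.snd h).symm
  intro X hX
  rw [mem_shift hne] at hX
  rcases hX with hX | ⟨_, hoX, hjX, hX⟩
  · exact hP hX.1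
  · have hX' := mem_indSets.1 (hP hX)
    rw [card_insert_erase hjX hoX] at hX'
    have hother : ∀ p ∈ X, p ≠ (i, o) → p ∈ insert (i, j) (X.erase (i, o)) := fun p hp hpo => by
      simp [hp, hpo]
    have hmem := Finset.mem_insert_self (i, j) (X.erase (i, o))
    refine mem_indSets.2 ⟨hX'.1, fun p hp => ?_, fun p hp q hq h => ?_⟩
    · by_cases hpo : p = (i, o)
      · subst hpo; exact hX'.2.1 (i, j) hmem
      · exact hX'.2.1 _ (hother p hp hpo)
    · by_cases hpo : p = (i, o) <;> by_cases hqo : q = (i, o)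
      · rw [hpo, hqo]
      · subst hpo
        exact absurd (hX'.2.2 (i, j) hmem _ (hother q hq hqo) h ▸ hq) hjX
      · subst hqo
        exact absurd (hX'.2.2 (i, j) hmem _ (hother p hp hpo) h.symm ▸ hp) hjX
      · exact hX'.2.2 p (hother p hp hpo) q (hother q hq hqo) h

/-- If one of two cross-intersecting families is stable under replacing labels by `o`, then their
members meet in vertices labelled `o`: a common vertex with another label can be removed from
the intersection by relabelling it in the first set. -/
lemma trace_inter_trace_nonempty {o : κ} {V W : Finset ι} {r r' : ℕ}
    {P Q : Finset (Finset (ι × κ))} (hP : P ⊆ indSets V r) (hQ : Q ⊆ indSets W r')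
    (h : CrossIntersecting P Q)
    (hsh : ∀ i j, j ≠ o → shift (i, o) (i, j) P = P) {a b : Finset (ι × κ)} (ha : a ∈ P)
    (hb : b ∈ Q) : (trace o a ∩ trace o b).Nonempty := by
  induction hN : (a ∩ b).card using Nat.strong_induction_on generalizing a with
  | _ N ih =>
  obtain ⟨⟨i, j⟩, hij⟩ := h a ha b hb
  have hij' := Finset.mem_inter.1 hij
  by_cases hj : j = o
  · subst hj
    exact ⟨i, by simpa using hij'⟩
  have hne : ((i, o) : ι × κ) ≠ (i, j) := fun h => hj (congrArg Prod.snd h).symm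
  have hoa : (i, o) ∉ a := fun h => hj (eq_label_of_mem (hP ha) hij'.1 h)
  have hob : (i, o) ∉ b := fun h => hj (eq_label_of_mem (hQ hb) hij'.2 h)
  have ha' := mem_of_shift_eq hne (hsh i j hj) ha hij'.1 hoa
  have hinter : insert (i, o) (a.erase (i, j)) ∩ b = (a ∩ b).erase (i, j) := by
    rw [Finset.insert_inter_of_notMem hob, Finset.erase_inter]
  obtain ⟨z, hz⟩ := ih _ (by rw [hinter, ← hN]; exact Finset.card_erase_lt_of_mem hij) ha' rfl
  refine ⟨z, ?_⟩
  simp only [Finset.mem_inter, mem_trace, Finset.mem_insert, Finset.mem_erase] at hz ⊢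
  refine ⟨?_, hz.2⟩
  rcases hz.1 with h' | h'
  · exact absurd (h' ▸ hz.2) hob
  · exact h'.2

end Traces

/-! ### Comparing weighted families, and cross-intersecting families of independent sets -/

section Weights

lemma mul_add_mul_le {w w' g g' e e' : ℕ} (hw : w' ≤ w) (h1 : g ≤ e)
    (h2 : w' ≠ 0 → g + g' ≤ e + e') : w * g + w' * g' ≤ w * e + w' * e' := by
  obtain ⟨d, rfl⟩ := Nat.exists_eq_add_of_le hw
  have h3 : w' * (g + g') ≤ w' * (e + e') := by
    rcases Nat.eq_zero_or_pos w' with h | h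
    · simp [h]
    · exact Nat.mul_le_mul_left _ (h2 h.ne')
  have h4 : d * g ≤ d * e := Nat.mul_le_mul_left _ h1
  linarith

lemma mul_add_mul_lt {w w' g g' e e' : ℕ} (hw : w' < w) (h1 : g < e)
    (h2 : w' ≠ 0 → g + g' ≤ e + e') : w * g + w' * g' < w * e + w' * e' := by
  obtain ⟨d, rfl⟩ := Nat.exists_eq_add_of_le hw.le
  have h3 : w' * (g + g') ≤ w' * (e + e') := by
    rcases Nat.eq_zero_or_pos w' with h | h
    · simp [h]
    · exact Nat.mul_le_mul_left _ (h2 h.ne')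
  have h4 : d * g < d * e := Nat.mul_lt_mul_of_pos_left h1 (by omega)
  linarith

lemma two_mul_sum_range (n : ℕ) (f : ℕ → ℕ) :
    2 * ∑ s ∈ Finset.range (n + 1), f s = ∑ s ∈ Finset.range (n + 1), (f s + f (n - s)) := by
  rw [Finset.sum_add_distrib, Finset.sum_flip (f := f), two_mul]

lemma pair_le {n : ℕ} {w g e : ℕ → ℕ} (hw : ∀ s, 2 * s ≤ n → w (n - s) ≤ w s)
    (h1 : ∀ s, 2 * s ≤ n → g s ≤ e s)
    (h2 : ∀ s, 2 * s ≤ n → w (n - s) ≠ 0 → g s + g (n - s) ≤ e s + e (n - s)) :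
    ∀ s ∈ Finset.range (n + 1),
      w s * g s + w (n - s) * g (n - s) ≤ w s * e s + w (n - s) * e (n - s) := by
  intro s hs
  rw [Finset.mem_range] at hs
  rcases Nat.le_total (2 * s) n with h | h
  · exact mul_add_mul_le (hw s h) (h1 s h) (h2 s h)
  · have h' : 2 * (n - s) ≤ n := by omega
    have := mul_add_mul_le (hw _ h') (h1 _ h') (h2 _ h')
    rw [Nat.sub_sub_self (by omega)] at this
    linarith

/-- With weights that do not increase from size `s` to size `n - s`, it suffices to compare the
numbers of sets of size `s` for `2 * s ≤ n`, and the numbers of sets of size `s` or `n - s`. -/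
lemma sum_mul_le_sum_mul {n : ℕ} {w g e : ℕ → ℕ} (hw : ∀ s, 2 * s ≤ n → w (n - s) ≤ w s)
    (h1 : ∀ s, 2 * s ≤ n → g s ≤ e s)
    (h2 : ∀ s, 2 * s ≤ n → w (n - s) ≠ 0 → g s + g (n - s) ≤ e s + e (n - s)) :
    ∑ s ∈ Finset.range (n + 1), w s * g s ≤ ∑ s ∈ Finset.range (n + 1), w s * e s := by
  have := Finset.sum_le_sum (pair_le hw h1 h2)
  rw [← two_mul_sum_range n fun s => w s * g s, ← two_mul_sum_range n fun s => w s * e s] at this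
  omega

lemma sum_mul_lt_sum_mul {n : ℕ} {w g e : ℕ → ℕ} (hw : ∀ s, 2 * s ≤ n → w (n - s) ≤ w s)
    (h1 : ∀ s, 2 * s ≤ n → g s ≤ e s)
    (h2 : ∀ s, 2 * s ≤ n → w (n - s) ≠ 0 → g s + g (n - s) ≤ e s + e (n - s))
    {s : ℕ} (hs : 2 * s ≤ n) (hws : w (n - s) < w s) (hge : g s < e s) :
    ∑ s ∈ Finset.range (n + 1), w s * g s < ∑ s ∈ Finset.range (n + 1), w s * e s := by
  have := Finset.sum_lt_sum (pair_le hw h1 h2)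
    ⟨s, Finset.mem_range.2 (by omega), mul_add_mul_lt hws hge (h2 s hs)⟩
  rw [← two_mul_sum_range n fun s => w s * g s, ← two_mul_sum_range n fun s => w s * e s] at this
  omega

lemma traceWeight_anti {N r k : ℕ} (hk : 2 ≤ k) (hr : r ≤ N) {s t : ℕ} (hst : s ≤ t) :
    traceWeight N r k t ≤ traceWeight N r k s := by
  unfold traceWeight
  by_cases ht : t ≤ r
  · rw [if_pos ht, if_pos (hst.trans ht)]
    refine Nat.mul_le_mul ?_ (Nat.pow_le_pow_right (by omega) (by omega))
    rw [Nat.choose_symm_of_eq_add (show N - t = (r - t) + (N - r) by omega),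
      Nat.choose_symm_of_eq_add (show N - s = (r - s) + (N - r) by omega)]
    exact Nat.choose_le_choose _ (by omega)
  · rw [if_neg ht]
    exact Nat.zero_le _

lemma traceWeight_self (N r k : ℕ) : traceWeight N r k r = 1 := by
  simp [traceWeight]

lemma le_of_traceWeight_ne_zero {N r k t : ℕ} (h : traceWeight N r k t ≠ 0) : t ≤ r := by
  by_contra ht
  exact h (if_neg ht)

end Weights

section CrossIndSets

variable {ι κ : Type*} [Fintype ι] [DecidableEq ι] [Fintype κ] [DecidableEq κ]

omit [Fintype ι] in
/-- The number of subsets of size `s` meeting a set is at least what complementation gives. -/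
lemma choose_le_card_filter_inter {V H : Finset ι} (hH : H ⊆ V) (s : ℕ) :
    V.card.choose s ≤ ((V.powerset.filter fun T => (T ∩ H).Nonempty).filter
      fun T => T.card = s).card + (V.card - H.card).choose s := by
  rw [← Finset.card_sdiff_of_subset hH, ← Finset.card_powersetCard s V,
    ← Finset.card_powersetCard s (V \ H)]
  refine le_trans (Finset.card_le_card fun T hT => ?_) (Finset.card_union_le _ _)
  rw [Finset.mem_powersetCard] at hT
  rw [Finset.mem_union, Finset.mem_filter, Finset.mem_filter, Finset.mem_powerset,
    Finset.mem_powersetCard]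
  by_cases h : (T ∩ H).Nonempty
  · exact Or.inl ⟨⟨hT.1, h⟩, hT.2⟩
  · refine Or.inr ⟨fun i hi => Finset.mem_sdiff.2 ⟨hT.1 hi, fun hiH => h ⟨i, ?_⟩⟩, hT.2⟩
    exact Finset.mem_inter.2 ⟨hi, hiH⟩

lemma choose_succ_le_choose {m s t : ℕ} (hs : 1 ≤ s) (hst : s < t) (hm : 2 * s ≤ m) :
    (m - t).choose s + 1 ≤ (m - s).choose s := by
  obtain ⟨u, rfl⟩ : ∃ u, s = u + 1 := ⟨s - 1, by omega⟩
  obtain ⟨v, hv⟩ : ∃ v, m - (u + 1) = v + 1 := ⟨m - (u + 1) - 1, by omega⟩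
  rw [hv, Nat.choose_succ_succ]
  have h1 : 0 < v.choose u := Nat.choose_pos (by omega)
  have h2 := Nat.choose_le_choose (u + 1) (show m - t ≤ v by omega)
  simp only [Nat.succ_eq_add_one]
  omega

lemma choose_le_ite {a s : ℕ} (h : a ≤ s) : a.choose s ≤ if a = s then 1 else 0 := by
  split_ifs with h'
  · rw [h', Nat.choose_self]
  · rw [Nat.choose_eq_zero_of_lt (by omega)]

omit [Fintype ι] [DecidableEq ι] in
lemma slice_subset_powersetCard {V : Finset ι} {G : Finset (Finset ι)} (hG : G ⊆ V.powerset)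
    (s : ℕ) : (G.filter fun T => T.card = s) ⊆ V.powersetCard s := fun T hT => by
  rw [Finset.mem_filter] at hT
  exact Finset.mem_powersetCard.2 ⟨Finset.mem_powerset.1 (hG hT.1), hT.2⟩

omit [Fintype ι] in
/-- Weighted form of Hilton's bound: among the pairs of nonempty cross-intersecting families of
sets of size at most `ρ`, the slices of `{H}` and of the family of all sets meeting `H`, where
`H` has size `ρ`, dominate. -/
lemma sum_weight_cross_le {V H : Finset ι} {ρ k : ℕ} (hk : 2 ≤ k) (hH : H ⊆ V)
    (hHρ : H.card = ρ) {G G' : Finset (Finset ι)} (hG : G ⊆ V.powerset) (hG' : G' ⊆ V.powerset)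
    (hGρ : ∀ T ∈ G, T.card ≤ ρ) (hGρ' : ∀ T ∈ G', T.card ≤ ρ) (hne : G.Nonempty)
    (hne' : G'.Nonempty) (h : CrossIntersecting G G') :
    ∑ s ∈ Finset.range (V.card + 1), traceWeight V.card ρ k s *
        ((G.filter fun T => T.card = s).card + (G'.filter fun T => T.card = s).card) ≤
      ∑ s ∈ Finset.range (V.card + 1), traceWeight V.card ρ k s *
        (((V.powerset.filter fun T => (T ∩ H).Nonempty).filter fun T => T.card = s).card +
          if s = ρ then 1 else 0) := by
  have hρV : ρ ≤ V.card := hHρ ▸ Finset.card_le_card hH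
  -- a slice is small as soon as the other family has a member
  have hone : ∀ {G G' : Finset (Finset ι)}, G ⊆ V.powerset → G' ⊆ V.powerset →
      (∀ T ∈ G', T.card ≤ ρ) → G'.Nonempty → CrossIntersecting G G' → ∀ s,
      (G.filter fun T => T.card = s).card + (V.card - ρ).choose s ≤ V.card.choose s := by
    intro G G' hG hG' hGρ' hne' h s
    obtain ⟨T, hT⟩ := hne'
    have h1 := card_add_card_powersetCard_sdiff_le (slice_subset_powersetCard hG s)
      (Finset.mem_powerset.1 (hG' hT)) fun a ha => h a (Finset.mem_filter.1 ha).1 T hT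
    have h2 := Nat.choose_le_choose s (show V.card - ρ ≤ V.card - T.card by
      have := hGρ' T hT; omega)
    omega
  refine sum_mul_le_sum_mul (fun s hs => traceWeight_anti hk hρV (by omega)) ?_ ?_
  · intro s hs
    have hM := choose_le_card_filter_inter hH s
    rw [hHρ] at hM
    rcases (G.filter fun T => T.card = s).eq_empty_or_nonempty with hA | hA
    · have := hone hG' hG hGρ hne h.symm s
      rw [hA, Finset.card_empty]
      omega
    rcases (G'.filter fun T => T.card = s).eq_empty_or_nonempty with hB | hB
    · have := hone hG hG' hGρ' hne' h s
      rw [hB, Finset.card_empty]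
      omega
    have hsl : CrossIntersecting (G.filter fun T => T.card = s) (G'.filter fun T => T.card = s) :=
      h.mono (Finset.filter_subset _ _) (Finset.filter_subset _ _)
    have hc := hsl.card_add_card_add_choose_le hs (slice_subset_powersetCard hG s)
      (slice_subset_powersetCard hG' s) hA hB
    obtain ⟨a, ha⟩ := hA
    obtain ⟨b, hb⟩ := hB
    obtain ⟨z, hz⟩ := hsl a ha b hb
    have hpos := Finset.card_pos.2 ⟨z, (Finset.mem_inter.1 hz).1⟩
    rw [Finset.mem_filter] at ha
    have hsρ := hGρ a ha.1
    rw [ha.2] at hsρ hpos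
    split_ifs with hs'
    · subst hs'
      omega
    · have := choose_succ_le_choose (t := ρ) hpos (by omega) hs
      omega
  · intro s hs hw
    have hsρ := le_of_traceWeight_ne_zero hw
    have h1 := (h.mono (Finset.filter_subset (fun T => T.card = s) _)
      (Finset.filter_subset (fun T => T.card = V.card - s) _)).card_add_card_le (by omega)
      (slice_subset_powersetCard hG s) (slice_subset_powersetCard hG' _)
    have h2 := (h.symm.mono (Finset.filter_subset (fun T => T.card = s) _)
      (Finset.filter_subset (fun T => T.card = V.card - s) _)).card_add_card_le (by omega)
      (slice_subset_powersetCard hG' s) (slice_subset_powersetCard hG _)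
    have h3 := choose_le_card_filter_inter hH s
    have h4 := choose_le_card_filter_inter hH (V.card - s)
    rw [hHρ] at h3 h4
    rw [Nat.choose_symm (by omega)] at h4
    have h5 := choose_le_ite (show V.card - ρ ≤ s by omega)
    have h6 := choose_le_ite (show V.card - ρ ≤ V.card - s by omega)
    split_ifs at h5 h6 ⊢ <;> omega

/-- The label weight used to iterate shifts towards the label `o`. -/
def labelWeight (o : κ) (p : ι × κ) : ℕ := if p.2 = o then 0 else 1

omit [Fintype ι] [DecidableEq ι] [Fintype κ] in
lemma labelWeight_lt {o j : κ} (hj : j ≠ o) (i : ι) :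
    labelWeight o (i, o) < labelWeight o (i, j) := by
  simp [labelWeight, hj]

omit [Fintype ι] [DecidableEq ι] [Fintype κ] [DecidableEq κ] in
lemma pair_ne_pair {o j : κ} (hj : j ≠ o) (i : ι) : ((i, o) : ι × κ) ≠ (i, j) :=
  fun h => hj (congrArg Prod.snd h).symm

/-- A family all of whose members have traces in `G` has at most the weight of `G`. -/
lemma card_le_sum_traceWeight (o : κ) {V : Finset ι} {r : ℕ} {P : Finset (Finset (ι × κ))}
    (hP : P ⊆ indSets V r) :
    P.card ≤ ∑ s ∈ Finset.range (V.card + 1), traceWeight V.card r (Fintype.card κ) s *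
      ((P.image (trace o)).filter fun T => T.card = s).card := by
  rw [← card_filter_trace_mem]
  · exact Finset.card_le_card fun X hX =>
      Finset.mem_filter.2 ⟨hP hX, Finset.mem_image_of_mem _ hX⟩
  · intro T hT
    obtain ⟨X, hX, rfl⟩ := Finset.mem_image.1 hT
    exact Finset.mem_powerset.2 (trace_subset (hP hX))

/-- Two nonempty cross-intersecting families of independent sets of size `ρ` are together at most
as large as the family of a single set `H × {o}` and the family of all sets meeting it. -/
theorem CrossIntersecting.card_add_card_le_indSets (o : κ) (hk : 2 ≤ Fintype.card κ)
    {V H : Finset ι} {ρ : ℕ} (hH : H ⊆ V) (hHρ : H.card = ρ) {P Q : Finset (Finset (ι × κ))}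
    (hP : P ⊆ indSets V ρ) (hQ : Q ⊆ indSets V ρ) (hPne : P.Nonempty) (hQne : Q.Nonempty)
    (h : CrossIntersecting P Q) :
    P.card + Q.card ≤
      ((indSets V ρ).filter fun Y : Finset (ι × κ) => (trace o Y ∩ H).Nonempty).card + 1 := by
  induction hN : totalWeight (labelWeight o) P + totalWeight (labelWeight o) Q
    using Nat.strong_induction_on generalizing P Q with
  | _ N ih =>
  by_cases hsh : ∀ i j, j ≠ o → shift (i, o) (i, j) P = P ∧ shift (i, o) (i, j) Q = Q
  · have hcross : CrossIntersecting (P.image (trace o)) (Q.image (trace o)) := by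
      intro S hS T hT
      obtain ⟨X, hX, rfl⟩ := Finset.mem_image.1 hS
      obtain ⟨Y, hY, rfl⟩ := Finset.mem_image.1 hT
      exact trace_inter_trace_nonempty hP hQ h (fun i j hj => (hsh i j hj).1) hX hY
    have hsub : ∀ {P : Finset (Finset (ι × κ))}, P ⊆ indSets V ρ →
        P.image (trace o) ⊆ V.powerset := fun hP T hT => by
      obtain ⟨X, hX, rfl⟩ := Finset.mem_image.1 hT
      exact Finset.mem_powerset.2 (trace_subset (hP hX))
    have hcard : ∀ {P : Finset (Finset (ι × κ))}, P ⊆ indSets V ρ →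
        ∀ T ∈ P.image (trace o), T.card ≤ ρ := fun hP T hT => by
      obtain ⟨X, hX, rfl⟩ := Finset.mem_image.1 hT
      exact card_trace_le (hP hX)
    have hsum := sum_weight_cross_le hk hH hHρ (hsub hP) (hsub hQ) (hcard hP) (hcard hQ)
      (hPne.image _) (hQne.image _) hcross
    simp only [mul_add, Finset.sum_add_distrib] at hsum
    have h1 := card_le_sum_traceWeight o hP
    have h2 := card_le_sum_traceWeight o hQ
    have h3 := card_filter_trace_mem o (V := V)
      (G := V.powerset.filter fun T => (T ∩ H).Nonempty) (Finset.filter_subset _ _) ρ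
    have h4 : ((indSets V ρ).filter fun X : Finset (ι × κ) =>
        trace o X ∈ V.powerset.filter fun T => (T ∩ H).Nonempty) =
        (indSets V ρ).filter fun Y => (trace o Y ∩ H).Nonempty := by
      refine Finset.filter_congr fun X hX => ?_
      rw [Finset.mem_filter, Finset.mem_powerset, and_iff_right (trace_subset hX)]
    rw [h4] at h3
    have h5 : ∑ s ∈ Finset.range (V.card + 1), traceWeight V.card ρ (Fintype.card κ) s *
        (if s = ρ then 1 else 0) = 1 := by
      simp only [mul_ite, mul_one, mul_zero, Finset.sum_ite_eq']
      rw [if_pos (Finset.mem_range.2 (Nat.lt_succ_of_le (hHρ ▸ Finset.card_le_card hH))),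
        traceWeight_self]
    omega
  · push Not at hsh
    obtain ⟨i, j, hj, hne⟩ := hsh
    have hlt := labelWeight_lt (ι := ι) hj i
    have hw : totalWeight (labelWeight o) (shift (i, o) (i, j) P) +
        totalWeight (labelWeight o) (shift (i, o) (i, j) Q) < N := by
      have hPle := totalWeight_shift_le hlt P
      have hQle := totalWeight_shift_le hlt Q
      by_cases hP' : shift (i, o) (i, j) P = P
      · have := totalWeight_shift_lt hlt (hne hP')
        omega
      · have := totalWeight_shift_lt hlt hP'
        omega
    have := ih _ hw (shift_subset_indSets hj hP) (shift_subset_indSets hj hQ)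
      (by rw [← Finset.card_pos, card_shift]; exact hPne.card_pos)
      (by rw [← Finset.card_pos, card_shift]; exact hQne.card_pos)
      (crossIntersecting_shift (pair_ne_pair hj i) h) rfl
    rwa [card_shift, card_shift] at this

end CrossIndSets

/-! ### The weight of a nontrivial intersecting family of traces -/

section TraceFamilies

variable {ι : Type*} [Fintype ι] [DecidableEq ι]

/-- The traces of the extremal families: the sets through `x` that meet `H`, and `H` itself. -/
def extTraces (x : ι) (H : Finset ι) : Finset (Finset ι) :=
  Finset.univ.filter fun T => (x ∈ T ∧ (T ∩ H).Nonempty) ∨ T = H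

lemma mem_extTraces {x : ι} {H T : Finset ι} :
    T ∈ extTraces x H ↔ (x ∈ T ∧ (T ∩ H).Nonempty) ∨ T = H := by
  simp [extTraces]

lemma card_le_of_notMem {T : Finset ι} {x : ι} (hx : x ∉ T) : T.card ≤ Fintype.card ι - 1 := by
  rw [← Finset.card_univ, ← Finset.card_erase_of_mem (Finset.mem_univ x)]
  exact Finset.card_le_card fun i hi =>
    Finset.mem_erase.2 ⟨by rintro rfl; exact hx hi, Finset.mem_univ _⟩

lemma choose_add_ite_le_card_extTraces {x : ι} {H : Finset ι} (hx : x ∉ H) {s : ℕ} (hs : 1 ≤ s) :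
    (Fintype.card ι - 1).choose (s - 1) + (if s = H.card then 1 else 0) ≤
      ((extTraces x H).filter fun T => T.card = s).card +
        (Fintype.card ι - 1 - H.card).choose (s - 1) := by
  have hH : H ⊆ Finset.univ.erase x := fun i hi =>
    Finset.mem_erase.2 ⟨by rintro rfl; exact hx hi, Finset.mem_univ _⟩
  have h1 := choose_le_card_filter_inter hH (s - 1)
  rw [Finset.card_erase_of_mem (Finset.mem_univ x), Finset.card_univ] at h1
  set S := ((Finset.univ.erase x).powerset.filter fun T => (T ∩ H).Nonempty).filter
    fun T => T.card = s - 1 with hS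
  have hxS : ∀ T ∈ S, x ∉ T := fun T hT hxT => by
    rw [hS, Finset.mem_filter, Finset.mem_filter, Finset.mem_powerset] at hT
    exact Finset.notMem_erase x _ (hT.1.1 hxT)
  have h2 : (S.image (insert x)).card = S.card := by
    refine Finset.card_image_of_injOn fun T hT T' hT' h => ?_
    rw [← Finset.erase_insert (hxS T hT), ← Finset.erase_insert (hxS T' hT')]
    exact congrArg (fun T => T.erase x) h
  have h3 : (if s = H.card then {H} else ∅ : Finset (Finset ι)).card =
      if s = H.card then 1 else 0 := by
    split_ifs <;> simp
  have h4 : S.image (insert x) ∪ (if s = H.card then {H} else ∅) ⊆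
      (extTraces x H).filter fun T => T.card = s := by
    intro T hT
    rw [Finset.mem_filter, mem_extTraces]
    rcases Finset.mem_union.1 hT with hT | hT
    · obtain ⟨T', hT', rfl⟩ := Finset.mem_image.1 hT
      rw [Finset.card_insert_of_notMem (hxS T' hT')]
      rw [hS, Finset.mem_filter, Finset.mem_filter] at hT'
      obtain ⟨i, hi⟩ := hT'.1.2
      rw [Finset.mem_inter] at hi
      exact ⟨Or.inl ⟨Finset.mem_insert_self _ _, i, Finset.mem_inter.2
        ⟨Finset.mem_insert_of_mem hi.1, hi.2⟩⟩, by omega⟩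
    · split_ifs at hT with h
      · rw [Finset.mem_singleton] at hT
        exact ⟨Or.inr hT, by rw [hT, h]⟩
      · simp at hT
  have h5 := Finset.card_le_card h4
  rw [Finset.card_union_of_disjoint, h2, h3] at h5
  · omega
  · rw [Finset.disjoint_left]
    intro T hT hT'
    obtain ⟨T', _, rfl⟩ := Finset.mem_image.1 hT
    split_ifs at hT' with h
    · rw [Finset.mem_singleton] at hT'
      exact hx (hT' ▸ Finset.mem_insert_self _ _)
    · simp at hT'

lemma card_slice_le_card_extTraces {r : ℕ} (hr : 3 ≤ r) (hrn : r ≤ Fintype.card ι)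
    {x : ι} {H : Finset ι} (hx : x ∉ H) (hH : H.card = min r (Fintype.card ι - 1))
    {G : Finset (Finset ι)} (hGr : ∀ T ∈ G, T.card ≤ r) (h : CrossIntersecting G G)
    (hnt : Nontriv G) {s : ℕ} (hs : 2 * s ≤ Fintype.card ι) :
    (G.filter fun T => T.card = s).card ≤ ((extTraces x H).filter fun T => T.card = s).card := by
  rcases (G.filter fun T => T.card = s).eq_empty_or_nonempty with hA | hA
  · rw [hA, Finset.card_empty]
    exact Nat.zero_le _
  have hsl : CrossIntersecting (G.filter fun T => T.card = s) (G.filter fun T => T.card = s) :=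
    h.mono (Finset.filter_subset _ _) (Finset.filter_subset _ _)
  have hsub : (G.filter fun T => T.card = s) ⊆ (Finset.univ : Finset ι).powersetCard s :=
    slice_subset_powersetCard (fun T _ => Finset.mem_powerset.2 (Finset.subset_univ T)) s
  obtain ⟨a, ha⟩ := hA
  have ha' := Finset.mem_filter.1 ha
  have hsr : s ≤ r := ha'.2 ▸ hGr a ha'.1
  have hs1 : 1 ≤ s := by
    obtain ⟨z, hz⟩ := h a ha'.1 a ha'.1
    rw [← ha'.2]
    exact Finset.card_pos.2 ⟨z, (Finset.mem_inter.1 hz).1⟩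
  have hE := choose_add_ite_le_card_extTraces hx hs1
  by_cases hntA : Nontriv (G.filter fun T => T.card = s)
  · have hs2 := two_le_of_nontriv hsub hsl hntA ⟨a, ha⟩
    have hHM := card_add_choose_le_of_nontriv hsl (by rwa [Finset.card_univ]) hsub hntA ⟨a, ha⟩
    rw [Finset.card_univ] at hHM
    split_ifs at hE with hsH
    · rw [← hsH] at hE
      omega
    · obtain ⟨u, rfl⟩ : ∃ u, s = u + 2 := ⟨s - 2, by omega⟩
      obtain ⟨v, hv⟩ : ∃ v, Fintype.card ι - 1 - (u + 2) = v + 1 :=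
        ⟨Fintype.card ι - 1 - (u + 2) - 1, by omega⟩
      have hp := Nat.choose_succ_succ v u
      have h1 : 0 < v.choose u := Nat.choose_pos (by omega)
      have h2 := Nat.choose_le_choose (u + 1) (show Fintype.card ι - 1 - H.card ≤ v by omega)
      rw [hv] at hHM
      simp only [Nat.add_succ_sub_one, Nat.succ_eq_add_one] at *
      omega
  · unfold Nontriv at hntA
    push Not at hntA
    obtain ⟨y, hy⟩ := hntA
    obtain ⟨B, hB, hyB⟩ := hnt y
    have h1 := card_star_add_le hsub (Finset.subset_univ B) hyB hy fun T hT =>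
      h T (Finset.mem_filter.1 hT).1 B hB
    rw [Finset.card_univ] at h1
    have h2 := hGr B hB
    have h3 := card_le_of_notMem hyB
    have h4 := Nat.choose_le_choose (s - 1)
      (show Fintype.card ι - 1 - H.card ≤ Fintype.card ι - 1 - B.card by omega)
    omega

lemma choose_le_card_extTraces_add {r : ℕ} (hr : 3 ≤ r) (hrn : r ≤ Fintype.card ι)
    {x : ι} {H : Finset ι} (hH : H.card = min r (Fintype.card ι - 1)) {s : ℕ}
    (hs : 2 * s ≤ Fintype.card ι) (hsr : Fintype.card ι - s ≤ r) :
    (Fintype.card ι).choose s ≤ ((extTraces x H).filter fun T => T.card = s).card +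
      ((extTraces x H).filter fun T => T.card = Fintype.card ι - s).card := by
  have hc : (((extTraces x H).filter fun T => T.card = Fintype.card ι - s).image
      fun T => Tᶜ).card = ((extTraces x H).filter fun T => T.card = Fintype.card ι - s).card :=
    Finset.card_image_of_injective _ compl_injective
  rw [← hc, ← Finset.card_univ, ← Finset.card_powersetCard s Finset.univ, Finset.card_univ]
  refine le_trans (Finset.card_le_card fun T hT => ?_) (Finset.card_union_le _ _)
  have hTs := (Finset.mem_powersetCard.1 hT).2
  have hTc : Tᶜ.card = Fintype.card ι - s := by rw [Finset.card_compl, hTs]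
  rw [Finset.mem_union, Finset.mem_filter]
  by_cases hTE : T ∈ extTraces x H
  · exact Or.inl ⟨hTE, hTs⟩
  refine Or.inr (Finset.mem_image.2 ⟨Tᶜ, Finset.mem_filter.2 ⟨?_, hTc⟩, compl_compl T⟩)
  rw [mem_extTraces, not_or, not_and] at hTE
  rw [mem_extTraces]
  by_cases hxT : x ∈ T
  · -- now `H` is contained in the complement of `T`, which is too small to be larger
    have hdis := Finset.not_nonempty_iff_eq_empty.1 (hTE.1 hxT)
    have hsub : H ⊆ Tᶜ := fun i hi => Finset.mem_compl.2 fun hiT => by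
      have : i ∈ T ∩ H := Finset.mem_inter.2 ⟨hiT, hi⟩
      rw [hdis] at this
      simp at this
    have hle := card_le_of_notMem (T := Tᶜ) (x := x) (by simpa using hxT)
    exact Or.inr (Finset.eq_of_subset_of_card_le hsub (by omega)).symm
  · refine Or.inl ⟨Finset.mem_compl.2 hxT, ?_⟩
    by_contra hdis
    rw [Finset.not_nonempty_iff_eq_empty] at hdis
    have hsub : H ⊆ T := fun i hi => by
      by_contra hiT
      have : i ∈ Tᶜ ∩ H := Finset.mem_inter.2 ⟨Finset.mem_compl.2 hiT, hi⟩
      rw [hdis] at this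
      simp at this
    have hle := Finset.card_le_card hsub
    exact hTE.2 (Finset.eq_of_subset_of_card_le hsub (by omega)).symm

lemma card_slice_add_card_slice_le {G : Finset (Finset ι)} (h : CrossIntersecting G G) {s : ℕ}
    (hs : s ≤ Fintype.card ι) :
    (G.filter fun T => T.card = s).card + (G.filter fun T => T.card = Fintype.card ι - s).card ≤
      (Fintype.card ι).choose s := by
  have hG : G ⊆ (Finset.univ : Finset ι).powerset :=
    fun T _ => Finset.mem_powerset.2 (Finset.subset_univ T)
  have := (h.mono (Finset.filter_subset (fun T => T.card = s) _)
    (Finset.filter_subset (fun T => T.card = Fintype.card ι - s) _)).card_add_card_le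
    (V := Finset.univ) (s := s) (by rwa [Finset.card_univ]) (slice_subset_powersetCard hG s)
    (by rw [Finset.card_univ]; exact slice_subset_powersetCard hG _)
  rwa [Finset.card_univ] at this

/-- Among the nontrivial intersecting families of sets of size at most `r`, the family of all sets
through `x` meeting `H`, together with `H`, has the largest weight. -/
lemma sum_weight_nontriv_le {r k : ℕ} (hk : 2 ≤ k) (hr : 3 ≤ r) (hrn : r ≤ Fintype.card ι)
    {x : ι} {H : Finset ι} (hx : x ∉ H) (hH : H.card = min r (Fintype.card ι - 1))
    {G : Finset (Finset ι)} (hGr : ∀ T ∈ G, T.card ≤ r) (h : CrossIntersecting G G)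
    (hnt : Nontriv G) :
    ∑ s ∈ Finset.range (Fintype.card ι + 1), traceWeight (Fintype.card ι) r k s *
        (G.filter fun T => T.card = s).card ≤
      ∑ s ∈ Finset.range (Fintype.card ι + 1), traceWeight (Fintype.card ι) r k s *
        ((extTraces x H).filter fun T => T.card = s).card :=
  sum_mul_le_sum_mul (fun s hs => traceWeight_anti hk hrn (by omega))
    (fun s hs => card_slice_le_card_extTraces hr hrn hx hH hGr h hnt hs)
    fun s hs hw => (card_slice_add_card_slice_le h (by omega)).trans
      (choose_le_card_extTraces_add hr hrn hH hs (le_of_traceWeight_ne_zero hw))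

/-- In the case of equality there are at least `H.card` sets of size two. -/
lemma card_le_card_pairs_of_sum_weight_le {r k : ℕ} (hk : 2 ≤ k) (hr : 3 ≤ r)
    (hrn : r ≤ Fintype.card ι) {x : ι} {H : Finset ι} (hx : x ∉ H)
    (hH : H.card = min r (Fintype.card ι - 1)) (hn : 4 ≤ Fintype.card ι)
    (hw : traceWeight (Fintype.card ι) r k (Fintype.card ι - 2) <
      traceWeight (Fintype.card ι) r k 2)
    {G : Finset (Finset ι)} (hGr : ∀ T ∈ G, T.card ≤ r) (h : CrossIntersecting G G)
    (hnt : Nontriv G)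
    (heq : ∑ s ∈ Finset.range (Fintype.card ι + 1), traceWeight (Fintype.card ι) r k s *
        ((extTraces x H).filter fun T => T.card = s).card ≤
      ∑ s ∈ Finset.range (Fintype.card ι + 1), traceWeight (Fintype.card ι) r k s *
        (G.filter fun T => T.card = s).card) :
    H.card ≤ (G.filter fun T => T.card = 2).card := by
  by_contra hlt
  have hE := choose_add_ite_le_card_extTraces hx (s := 2) (by omega)
  rw [if_neg (by omega)] at hE
  simp only [Nat.reduceSub, Nat.choose_one_right] at hE
  refine absurd heq (not_le.2 (sum_mul_lt_sum_mul
    (fun s hs => traceWeight_anti hk hrn (by omega))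
    (fun s hs => card_slice_le_card_extTraces hr hrn hx hH hGr h hnt hs)
    (fun s hs hw => (card_slice_add_card_slice_le h (by omega)).trans
      (choose_le_card_extTraces_add hr hrn hH hs (le_of_traceWeight_ne_zero hw)))
    (s := 2) (by omega) hw (by omega)))

/-- The condition under which the extremal families are unique: it makes sets of size two strictly
heavier than sets of size `n - 2`. -/
lemma traceWeight_sub_two_lt {n r k : ℕ} (hk : 2 ≤ k) (hrn : r ≤ n)
    (h : (4 ≤ r ∧ r < n) ∨ (r = n ∧ 5 ≤ n ∧ 3 ≤ k)) :
    traceWeight n r k (n - 2) < traceWeight n r k 2 := by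
  unfold traceWeight
  rw [if_pos (show 2 ≤ r by omega), Nat.choose_symm_of_eq_add
    (show n - 2 = (r - 2) + (n - r) by omega)]
  have hpos : 0 < (n - 2).choose (n - r) * (k - 1) ^ (r - 2) :=
    Nat.mul_pos (Nat.choose_pos (by omega)) (Nat.pow_pos (by omega))
  split_ifs with h2
  swap
  · exact hpos
  rw [show n - (n - 2) = 2 by omega]
  rcases h with h | h
  · refine Nat.mul_lt_mul_of_lt_of_le ?_ (Nat.pow_le_pow_right (by omega) (by omega))
      (Nat.pow_pos (by omega))
    rcases (show r = n - 1 ∨ r = n - 2 by omega) with hr | hr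
    · rw [show n - r = 1 by omega, show r - (n - 2) = 1 by omega]
      simp only [Nat.choose_one_right]
      omega
    · rw [show n - r = 2 by omega, show r - (n - 2) = 0 by omega]
      have := Nat.choose_le_choose 2 (show 3 ≤ n - 2 by omega)
      rw [Nat.choose_zero_right]
      rw [show Nat.choose 3 2 = 3 by rfl] at this
      omega
  · rw [show n - r = 0 by omega, show r - (n - 2) = 2 by omega, Nat.choose_zero_right,
      Nat.choose_self]
    simp only [one_mul]
    exact Nat.pow_lt_pow_right (by omega) (by omega)

/-- A nontrivial intersecting family with many pairs: the pairs form a star, and a member avoiding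
its centre contains all of its leaves. -/
lemma exists_subset_extTraces {h : ℕ} (hh : 4 ≤ h) {G : Finset (Finset ι)}
    (hcross : CrossIntersecting G G) (hnt : Nontriv G)
    (hGh : ∀ x, ∀ T ∈ G, x ∉ T → T.card ≤ h) (h2 : h ≤ (G.filter fun T => T.card = 2).card) :
    ∃ x H, x ∉ H ∧ H.card = h ∧ G ⊆ extTraces x H := by
  have hsub : (G.filter fun T => T.card = 2) ⊆ (Finset.univ : Finset ι).powersetCard 2 :=
    slice_subset_powersetCard (fun T _ => Finset.mem_powerset.2 (Finset.subset_univ T)) 2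
  have hcross2 : CrossIntersecting (G.filter fun T => T.card = 2) (G.filter fun T => T.card = 2) :=
    hcross.mono (Finset.filter_subset _ _) (Finset.filter_subset _ _)
  have hne : (G.filter fun T => T.card = 2).Nonempty := Finset.card_pos.1 (by omega)
  have hn : 4 ≤ Fintype.card ι := by
    by_contra hn
    have h1 := Finset.card_le_card hsub
    rw [Finset.card_powersetCard, Finset.card_univ] at h1
    have h3 := Nat.choose_le_choose 2 (show Fintype.card ι ≤ 3 by omega)
    rw [show Nat.choose 3 2 = 3 by rfl] at h3
    omega
  have htriv : ¬ Nontriv (G.filter fun T => T.card = 2) := fun hnt2 => by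
    have := card_add_choose_le_of_nontriv hcross2 (by rw [Finset.card_univ]; omega) hsub hnt2 hne
    rw [Finset.card_univ] at this
    simp only [Nat.reduceSub, Nat.choose_one_right] at this
    omega
  unfold Nontriv at htriv
  push Not at htriv
  obtain ⟨x, hx⟩ := htriv
  set N := Finset.univ.filter fun i => i ≠ x ∧ {x, i} ∈ G with hN
  have hxN : x ∉ N := by simp [hN]
  have hcard : h ≤ N.card := by
    refine h2.trans (le_trans (Finset.card_le_card fun T hT => ?_)
      (Finset.card_image_le (s := N) (f := fun i => ({x, i} : Finset ι))))
    have hxT := hx T hT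
    obtain ⟨hTG, hT2⟩ := Finset.mem_filter.1 hT
    obtain ⟨i, hi⟩ := Finset.card_eq_one.1 (show (T.erase x).card = 1 by
      rw [Finset.card_erase_of_mem hxT, hT2])
    have hTi : T = {x, i} := by rw [← Finset.insert_erase hxT, hi]
    refine Finset.mem_image.2 ⟨i, Finset.mem_filter.2 ⟨Finset.mem_univ _, ?_, hTi ▸ hTG⟩, hTi.symm⟩
    rintro rfl
    have : i ∈ T.erase i := by rw [hi]; exact Finset.mem_singleton_self _
    exact Finset.notMem_erase _ _ this
  have havoid : ∀ T ∈ G, x ∉ T → T = N := by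
    intro T hT hxT
    have hsub : N ⊆ T := by
      intro i hi
      obtain ⟨z, hz⟩ := hcross T hT _ (Finset.mem_filter.1 hi).2.2
      rw [Finset.mem_inter, Finset.mem_insert, Finset.mem_singleton] at hz
      rcases hz with ⟨hzT, rfl | rfl⟩
      · exact absurd hzT hxT
      · exact hzT
    exact (Finset.eq_of_subset_of_card_le hsub ((hGh x T hT hxT).trans hcard)).symm
  obtain ⟨B, hB, hxB⟩ := hnt x
  have hBN := havoid B hB hxB
  refine ⟨x, N, hxN, le_antisymm (hBN ▸ hGh x B hB hxB) hcard, fun T hT => ?_⟩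
  rw [mem_extTraces]
  by_cases hxT : x ∈ T
  · exact Or.inl ⟨hxT, hBN ▸ hcross T hT B hB⟩
  · exact Or.inr (havoid T hT hxT)

end TraceFamilies

/-! ### The extremal families -/

section Extremal

variable {ι κ : Type*} [Fintype ι] [DecidableEq ι] [Fintype κ] [DecidableEq κ]

/-- The independent sets of size `r` that contain `v` and meet `L`, or avoid `v` and contain `L`.
This is an extremal family if `L` is an independent set of size `min r (n - 1)` without vertices
in the clique of `v`, where `n` is the number of cliques. For `r < n` the only member avoiding `v`
is then `L`; for `r = n` these members are the sets `L ∪ {(v.1, j)}` with `j ≠ v.2`. -/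
def extremal (r : ℕ) (v : ι × κ) (L : Finset (ι × κ)) : Finset (Finset (ι × κ)) :=
  (indSets Finset.univ r).filter fun X => (v ∈ X ∧ (X ∩ L).Nonempty) ∨ (v ∉ X ∧ L ⊆ X)

/-- The independent sets of size `r - 1` outside the clique `c` that meet `L`: the links at a
vertex of the clique `c` of the members of an extremal family through that vertex. -/
def linkFamily (r : ℕ) (c : ι) (L : Finset (ι × κ)) : Finset (Finset (ι × κ)) :=
  (indSets (Finset.univ.erase c) (r - 1)).filter fun Y => (Y ∩ L).Nonempty

/-- The set of the vertices labelled `o` in the cliques belonging to `H`. -/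
def constSet (o : κ) (H : Finset ι) : Finset (ι × κ) := H.image fun i => (i, o)

omit [Fintype ι] [Fintype κ] in
lemma mem_constSet {o : κ} {H : Finset ι} {p : ι × κ} :
    p ∈ constSet o H ↔ p.1 ∈ H ∧ p.2 = o := by
  obtain ⟨i, j⟩ := p
  simp only [constSet, Finset.mem_image, Prod.mk.injEq]
  constructor
  · rintro ⟨i, hi, rfl, rfl⟩
    exact ⟨hi, rfl⟩
  · rintro ⟨hi, rfl⟩
    exact ⟨i, hi, rfl, rfl⟩

lemma graph_mem_indSets (f : ι → κ) {V S : Finset ι} (hS : S ⊆ V) :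
    S.image (fun i => (i, f i)) ∈ indSets V S.card := by
  refine mem_indSets.2 ⟨Finset.card_image_of_injective _ fun i j h => congrArg Prod.fst h,
    fun p hp => ?_, fun p hp q hq h => ?_⟩
  · obtain ⟨i, hi, rfl⟩ := Finset.mem_image.1 hp
    exact hS hi
  · obtain ⟨i, _, rfl⟩ := Finset.mem_image.1 hp
    obtain ⟨j, _, rfl⟩ := Finset.mem_image.1 hq
    obtain rfl : i = j := h
    rfl

lemma constSet_mem_indSets (o : κ) {V H : Finset ι} (hH : H ⊆ V) :
    constSet o H ∈ indSets V H.card := graph_mem_indSets (fun _ => o) hH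

omit [Fintype κ] in
lemma inter_constSet_nonempty {o : κ} {H : Finset ι} {X : Finset (ι × κ)} :
    (X ∩ constSet o H).Nonempty ↔ (trace o X ∩ H).Nonempty := by
  constructor
  · rintro ⟨⟨i, j⟩, hp⟩
    rw [Finset.mem_inter, mem_constSet] at hp
    obtain ⟨hX, hi, rfl⟩ := hp
    exact ⟨i, Finset.mem_inter.2 ⟨mem_trace.2 hX, hi⟩⟩
  · rintro ⟨i, hi⟩
    rw [Finset.mem_inter, mem_trace] at hi
    exact ⟨(i, o), Finset.mem_inter.2 ⟨hi.1, mem_constSet.2 ⟨hi.2, rfl⟩⟩⟩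

omit [Fintype κ] in
lemma constSet_subset {o : κ} {H : Finset ι} {X : Finset (ι × κ)} :
    constSet o H ⊆ X ↔ H ⊆ trace o X := by
  constructor
  · intro h i hi
    exact mem_trace.2 (h (mem_constSet.2 ⟨hi, rfl⟩))
  · rintro h ⟨i, j⟩ hp
    obtain ⟨hi, rfl⟩ := mem_constSet.1 hp
    exact mem_trace.1 (h hi)

lemma mem_extremal_constSet {r : ℕ} {o : κ} {x : ι} {H : Finset ι} (hx : x ∉ H)
    (hH : H.card = min r (Fintype.card ι - 1)) {X : Finset (ι × κ)} :
    X ∈ extremal r (x, o) (constSet o H) ↔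
      X ∈ indSets Finset.univ r ∧ trace o X ∈ extTraces x H := by
  rw [extremal, Finset.mem_filter, mem_extTraces, inter_constSet_nonempty, constSet_subset,
    ← mem_trace]
  refine and_congr_right fun hX => or_congr_right ⟨fun h => ?_, ?_⟩
  · have h1 := card_le_of_notMem h.1
    have h2 := card_trace_le (o := o) hX
    exact (Finset.eq_of_subset_of_card_le h.2 (by omega)).symm
  · rintro rfl
    exact ⟨hx, subset_rfl⟩

lemma card_extremal_constSet {r : ℕ} (o : κ) {x : ι} {H : Finset ι} (hx : x ∉ H)
    (hH : H.card = min r (Fintype.card ι - 1)) :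
    (extremal r (x, o) (constSet o H)).card =
      ∑ s ∈ Finset.range (Fintype.card ι + 1),
        traceWeight (Fintype.card ι) r (Fintype.card κ) s *
          ((extTraces x H).filter fun T => T.card = s).card := by
  have := card_filter_trace_mem o (V := Finset.univ) (G := extTraces x H)
    (fun T _ => Finset.mem_powerset.2 (Finset.subset_univ T)) r
  rw [Finset.card_univ] at this
  rw [← this]
  congr 1
  ext X
  rw [mem_extremal_constSet hx hH, Finset.mem_filter]

/-! ### Links at a vertex -/

lemma insert_mem_indSets {r : ℕ} (hr : 1 ≤ r) {V : Finset ι} {c : ι} (hcV : c ∈ V)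
    {Y : Finset (ι × κ)} (hY : Y ∈ indSets (V.erase c) (r - 1)) (l : κ) :
    insert (c, l) Y ∈ indSets V r ∧ (c, l) ∉ Y := by
  have hY' := mem_indSets.1 hY
  have hc : ∀ p ∈ Y, p.1 ≠ c := fun p hp => Finset.ne_of_mem_erase (hY'.2.1 p hp)
  have hcl : (c, l) ∉ Y := fun h => hc _ h rfl
  refine ⟨mem_indSets.2 ⟨?_, fun p hp => ?_, fun p hp q hq h => ?_⟩, hcl⟩
  · rw [Finset.card_insert_of_notMem hcl, hY'.1]
    omega
  · rcases Finset.mem_insert.1 hp with rfl | hp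
    · exact hcV
    · exact Finset.mem_of_mem_erase (hY'.2.1 p hp)
  · rcases Finset.mem_insert.1 hp with rfl | hp <;> rcases Finset.mem_insert.1 hq with rfl | hq
    · rfl
    · exact absurd h.symm (hc q hq)
    · exact absurd h (hc p hp)
    · exact hY'.2.2 p hp q hq h

lemma mem_indSets_erase_of_insert {r : ℕ} {v : ι × κ} {Y : Finset (ι × κ)}
    (h : insert v Y ∈ indSets Finset.univ r) (hv : v ∉ Y) :
    Y ∈ indSets (Finset.univ.erase v.1) (r - 1) := by
  have h' := mem_indSets.1 h
  rw [Finset.card_insert_of_notMem hv] at h'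
  refine mem_indSets.2 ⟨by omega, fun p hp => Finset.mem_erase.2 ⟨fun hpv => hv ?_,
    Finset.mem_univ _⟩, fun p hp q hq => h'.2.2 p (Finset.mem_insert_of_mem hp) q
      (Finset.mem_insert_of_mem hq)⟩
  rwa [← h'.2.2 p (Finset.mem_insert_of_mem hp) v (Finset.mem_insert_self _ _) hpv]

lemma memberSubfamily_subset_indSets {r : ℕ} {v : ι × κ} {F : Finset (Finset (ι × κ))}
    (hF : F ⊆ indSets Finset.univ r) :
    F.memberSubfamily v ⊆ indSets (Finset.univ.erase v.1) (r - 1) := fun Y hY => by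
  rw [Finset.mem_memberSubfamily] at hY
  exact mem_indSets_erase_of_insert (hF hY.1) hY.2

lemma notMem_of_mem_indSets_erase {s : ℕ} {c : ι} {l : κ} {L : Finset (ι × κ)}
    (hL : L ∈ indSets (Finset.univ.erase c) s) : (c, l) ∉ L := fun h =>
  Finset.notMem_erase c _ ((mem_indSets.1 hL).2.1 _ h)

lemma memberSubfamily_extremal {r s : ℕ} (hr : 1 ≤ r) {v : ι × κ} {L : Finset (ι × κ)}
    (hL : L ∈ indSets (Finset.univ.erase v.1) s) :
    (extremal r v L).memberSubfamily v = linkFamily r v.1 L := by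
  have hvL : v ∉ L := notMem_of_mem_indSets_erase hL
  ext Y
  rw [Finset.mem_memberSubfamily, extremal, Finset.mem_filter, linkFamily, Finset.mem_filter]
  have hins : insert v Y ∩ L = Y ∩ L := Finset.insert_inter_of_notMem hvL
  rw [hins]
  constructor
  · rintro ⟨⟨h1, h2⟩, h3⟩
    refine ⟨mem_indSets_erase_of_insert h1 h3, ?_⟩
    rcases h2 with h2 | h2
    · exact h2.2
    · exact absurd (Finset.mem_insert_self _ _) h2.1
  · rintro ⟨h1, h2⟩
    have := insert_mem_indSets hr (Finset.mem_univ _) h1 v.2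
    exact ⟨⟨this.1, Or.inl ⟨Finset.mem_insert_self _ _, h2⟩⟩, this.2⟩

/-! ### Automorphisms -/

/-- A permutation of the vertices preserves the cliques if it maps the pairs of vertices of a
common clique exactly to such pairs. -/
def PreservesCliques (σ : Equiv.Perm (ι × κ)) : Prop :=
  ∀ p q, (σ p).1 = (σ q).1 ↔ p.1 = q.1

omit [Fintype ι] [DecidableEq ι] [Fintype κ] [DecidableEq κ] in
lemma PreservesCliques.symm {σ : Equiv.Perm (ι × κ)} (h : PreservesCliques σ) :
    PreservesCliques σ.symm := fun p q => by
  rw [← h (σ.symm p) (σ.symm q), Equiv.apply_symm_apply, Equiv.apply_symm_apply]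

lemma PreservesCliques.image_mem_indSets {σ : Equiv.Perm (ι × κ)} (h : PreservesCliques σ) {r : ℕ}
    {X : Finset (ι × κ)} (hX : X ∈ indSets Finset.univ r) :
    X.image σ ∈ indSets Finset.univ r := by
  have hX' := mem_indSets.1 hX
  refine mem_indSets.2 ⟨by rw [Finset.card_image_of_injective _ σ.injective, hX'.1],
    fun _ _ => Finset.mem_univ _, fun p hp q hq hpq => ?_⟩
  obtain ⟨p, hpX, rfl⟩ := Finset.mem_image.1 hp
  obtain ⟨q, hqX, rfl⟩ := Finset.mem_image.1 hq
  rw [hX'.2.2 p hpX q hqX ((h p q).1 hpq)]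

lemma PreservesCliques.image_mem_extremal {σ : Equiv.Perm (ι × κ)} (h : PreservesCliques σ) {r : ℕ}
    {v : ι × κ} {L X : Finset (ι × κ)} (hX : X ∈ extremal r v L) :
    X.image σ ∈ extremal r (σ v) (L.image σ) := by
  rw [extremal, Finset.mem_filter] at hX ⊢
  refine ⟨h.image_mem_indSets hX.1, ?_⟩
  rw [σ.injective.mem_finset_image, ← Finset.image_inter _ _ σ.injective,
    Finset.image_nonempty, Finset.image_subset_image_iff σ.injective]
  exact hX.2

lemma PreservesCliques.image_extremal {σ : Equiv.Perm (ι × κ)} (h : PreservesCliques σ) (r : ℕ)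
    (v : ι × κ) (L : Finset (ι × κ)) :
    (extremal r v L).image (fun X => X.image σ) = extremal r (σ v) (L.image σ) := by
  have hinv : ∀ X : Finset (ι × κ), (X.image σ.symm).image σ = X := fun X => by
    rw [Finset.image_image, Equiv.self_comp_symm, Finset.image_id]
  have hinv' : ∀ X : Finset (ι × κ), (X.image σ).image σ.symm = X := fun X => by
    rw [Finset.image_image, Equiv.symm_comp_self, Finset.image_id]
  ext Z
  rw [Finset.mem_image]
  constructor
  · rintro ⟨X, hX, rfl⟩
    exact h.image_mem_extremal hX
  · intro hZ
    refine ⟨Z.image σ.symm, ?_, hinv Z⟩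
    have := h.symm.image_mem_extremal hZ
    rwa [Equiv.symm_apply_apply, hinv'] at this

/-- A permutation of the cliques taking `c` to `c'` and `S` to `S'`. -/
lemma exists_perm_image_eq {c c' : ι} {S S' : Finset ι} (hc : c ∉ S) (hc' : c' ∉ S')
    (hS : S.card = S'.card) : ∃ π : Equiv.Perm ι, π c = c' ∧ ∀ i ∈ S, π i ∈ S' := by
  let e : {i // i ∈ S} ≃ {i // i ∈ S'} := Finset.equivOfCardEq hS
  have h1 : ∀ i ∈ S, e.extendSubtype i ∈ S' := fun i hi => e.extendSubtype_mem i hi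
  have h2 : e.extendSubtype c ∉ S' := e.extendSubtype_not_mem c hc
  refine ⟨e.extendSubtype.trans (Equiv.swap (e.extendSubtype c) c'), by simp, fun i hi => ?_⟩
  rw [Equiv.trans_apply, Equiv.swap_apply_of_ne_of_ne]
  · exact h1 i hi
  · intro h; exact h2 (h ▸ h1 i hi)
  · intro h; exact hc' (h ▸ h1 i hi)

/-- Any two extremal families are equivalent under the automorphisms of the graph. -/
lemma exists_preservesCliques {s : ℕ} {v v' : ι × κ} {L L' : Finset (ι × κ)}
    (hL : L ∈ indSets (Finset.univ.erase v.1) s) (hL' : L' ∈ indSets (Finset.univ.erase v'.1) s) :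
    ∃ σ : Equiv.Perm (ι × κ), PreservesCliques σ ∧ σ v = v' ∧ L.image σ = L' := by
  have hM := (insert_mem_indSets (r := s + 1) (by omega) (Finset.mem_univ _) hL v.2).1
  have hM' := (insert_mem_indSets (r := s + 1) (by omega) (Finset.mem_univ _) hL' v'.2).1
  obtain ⟨π, hπc, hπ⟩ := exists_perm_image_eq (c := v.1) (c' := v'.1) (S := L.image Prod.fst)
    (S' := L'.image Prod.fst)
    (fun h => by
      obtain ⟨p, hp, hpv⟩ := Finset.mem_image.1 h
      exact Finset.ne_of_mem_erase ((mem_indSets.1 hL).2.1 p hp) hpv)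
    (fun h => by
      obtain ⟨p, hp, hpv⟩ := Finset.mem_image.1 h
      exact Finset.ne_of_mem_erase ((mem_indSets.1 hL').2.1 p hp) hpv)
    (by rw [card_image_fst hL, card_image_fst hL'])
  have : Nonempty κ := ⟨v.2⟩
  -- the labels of an independent set as a function of the clique
  have hlab : ∀ M : Finset (ι × κ), M ∈ indSets Finset.univ (s + 1) →
      ∃ g : ι → κ, ∀ p ∈ M, g p.1 = p.2 := by
    intro M hM
    refine ⟨fun i => if h : ∃ l, (i, l) ∈ M then h.choose else Classical.arbitrary κ,
      fun p hp => ?_⟩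
    have h : ∃ l, (p.1, l) ∈ M := ⟨p.2, hp⟩
    simp only [dif_pos h]
    exact eq_label_of_mem hM h.choose_spec hp
  obtain ⟨g, hg⟩ := hlab _ hM
  obtain ⟨g', hg'⟩ := hlab _ hM'
  have hgσ : ∀ p ∈ insert v L, (Equiv.prodShear π fun i => Equiv.swap (g i) (g' (π i))) p =
      (π p.1, g' (π p.1)) := by
    intro p hp
    rw [Equiv.prodShear_apply]
    simp only
    rw [← hg p hp, Equiv.swap_apply_left]
  refine ⟨Equiv.prodShear π fun i => Equiv.swap (g i) (g' (π i)), fun p q => ?_, ?_, ?_⟩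
  · simp
  · rw [hgσ v (Finset.mem_insert_self _ _), hπc]
    exact Prod.ext rfl (hg' v' (Finset.mem_insert_self _ _))
  · refine Finset.eq_of_subset_of_card_le (fun q hq => ?_) ?_
    · obtain ⟨p, hp, rfl⟩ := Finset.mem_image.1 hq
      rw [hgσ p (Finset.mem_insert_of_mem hp)]
      obtain ⟨q, hq, hqp⟩ := Finset.mem_image.1 (hπ p.1 (Finset.mem_image_of_mem _ hp))
      rw [← hqp, hg' q (Finset.mem_insert_of_mem hq)]
      exact hq
    · rw [Finset.card_image_of_injective _ (Equiv.injective _), (mem_indSets.1 hL).1,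
        (mem_indSets.1 hL').1]

lemma card_extremal_eq {r s : ℕ} {v v' : ι × κ} {L L' : Finset (ι × κ)}
    (hL : L ∈ indSets (Finset.univ.erase v.1) s) (hL' : L' ∈ indSets (Finset.univ.erase v'.1) s) :
    (extremal r v L).card = (extremal r v' L').card := by
  obtain ⟨σ, hσ, rfl, rfl⟩ := exists_preservesCliques hL hL'
  rw [← hσ.image_extremal, Finset.card_image_of_injective]
  exact Finset.image_injective σ.injective

lemma card_linkFamily_eq {r s : ℕ} (hr : 1 ≤ r) {c c' : ι} {L L' : Finset (ι × κ)} (o : κ)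
    (hL : L ∈ indSets (Finset.univ.erase c) s) (hL' : L' ∈ indSets (Finset.univ.erase c') s) :
    (linkFamily r c L).card = (linkFamily r c' L').card := by
  rw [← memberSubfamily_extremal (v := (c, o)) hr hL,
    ← memberSubfamily_extremal (v := (c', o)) hr hL']
  obtain ⟨σ, hσ, hσv, hσL⟩ := exists_preservesCliques (v := (c, o)) (v' := (c', o)) hL hL'
  have hinj : Function.Injective fun X : Finset (ι × κ) => X.image σ :=
    Finset.image_injective σ.injective
  have himg : ((extremal r (c, o) L).nonMemberSubfamily (c, o)).image (fun X => X.image σ) =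
      (extremal r (c', o) L').nonMemberSubfamily (c', o) := by
    rw [← hσv, ← hσL, ← hσ.image_extremal]
    ext Z
    simp only [Finset.mem_image, Finset.mem_nonMemberSubfamily]
    constructor
    · rintro ⟨X, ⟨hX, hvX⟩, rfl⟩
      exact ⟨⟨X, hX, rfl⟩, by rwa [σ.injective.mem_finset_image]⟩
    · rintro ⟨⟨X, hX, rfl⟩, hvX⟩
      exact ⟨X, ⟨hX, by rwa [σ.injective.mem_finset_image] at hvX⟩, rfl⟩
  have h1 := congrArg Finset.card himg
  rw [Finset.card_image_of_injective _ hinj] at h1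
  have h2 := Finset.card_memberSubfamily_add_card_nonMemberSubfamily (c, o) (extremal r (c, o) L)
  have h3 := Finset.card_memberSubfamily_add_card_nonMemberSubfamily (c', o)
    (extremal r (c', o) L')
  have h4 := card_extremal_eq (r := r) (v := (c, o)) (v' := (c', o)) hL hL'
  omega

end Extremal

/-! ### Links at two vertices of a clique -/

section Links

variable {ι κ : Type*} [Fintype ι] [DecidableEq ι] [Fintype κ] [DecidableEq κ]

lemma card_memberSubfamily {α : Type*} [DecidableEq α] (x : α) (A : Finset (Finset α)) :
    (A.memberSubfamily x).card = (A.filter fun a => x ∈ a).card := by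
  have h1 := Finset.card_memberSubfamily_add_card_nonMemberSubfamily x A
  have h2 := Finset.card_filter_add_card_filter_not (s := A) (fun a => x ∈ a)
  rw [Finset.nonMemberSubfamily] at h1
  omega

lemma card_le_of_mem_or_mem {α : Type*} [DecidableEq α] {x y : α} {A : Finset (Finset α)}
    (h : ∀ a ∈ A, x ∈ a ∨ y ∈ a) :
    A.card ≤ (A.memberSubfamily x).card + (A.memberSubfamily y).card := by
  rw [card_memberSubfamily, card_memberSubfamily]
  refine le_trans (Finset.card_le_card fun a ha => ?_) (Finset.card_union_le _ _)
  rw [← Finset.filter_or]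
  exact Finset.mem_filter.2 ⟨ha, h a ha⟩

lemma CrossIntersecting.links_indSets {r : ℕ} {F : Finset (Finset (ι × κ))}
    (hF : F ⊆ indSets Finset.univ r) (h : CrossIntersecting F F) {i : ι} {j l : κ} (hjl : j ≠ l) :
    CrossIntersecting (F.memberSubfamily (i, j)) (F.memberSubfamily (i, l)) := by
  intro Y hY Z hZ
  have hY' := memberSubfamily_subset_indSets hF hY
  have hZ' := memberSubfamily_subset_indSets hF hZ
  rw [Finset.mem_memberSubfamily] at hY hZ
  obtain ⟨z, hz⟩ := h _ hY.1 _ hZ.1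
  rw [Finset.mem_inter, Finset.mem_insert, Finset.mem_insert] at hz
  rcases hz with ⟨rfl | h1, h2 | h2⟩
  · exact absurd (congrArg Prod.snd h2) hjl
  · exact absurd h2 (notMem_of_mem_indSets_erase hZ')
  · exact absurd (h2 ▸ h1) (notMem_of_mem_indSets_erase hY')
  · exact ⟨z, Finset.mem_inter.2 ⟨h1, h2⟩⟩

omit [DecidableEq κ] in
lemma exists_ne_label (hk : 2 ≤ Fintype.card κ) (o : κ) : ∃ l : κ, l ≠ o := by
  have : Nontrivial κ := Fintype.one_lt_card_iff_nontrivial.1 hk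
  exact exists_ne o

lemma filter_trace_eq_linkFamily (r : ℕ) (o : κ) (i : ι) (H : Finset ι) :
    ((indSets (Finset.univ.erase i) (r - 1)).filter fun Y : Finset (ι × κ) =>
      (trace o Y ∩ H).Nonempty) = linkFamily r i (constSet o H) := by
  refine Finset.filter_congr fun Y _ => ?_
  rw [inter_constSet_nonempty]

lemma card_univ_erase (i : ι) : (Finset.univ.erase i).card = Fintype.card ι - 1 := by
  rw [Finset.card_erase_of_mem (Finset.mem_univ i), Finset.card_univ]

section

variable {r : ℕ} {i c : ι} {P Q : Finset (Finset (ι × κ))} {L : Finset (ι × κ)}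

lemma card_add_card_le_linkFamily (hk : 2 ≤ Fintype.card κ) (hrn : r ≤ Fintype.card ι)
    (hr : 1 ≤ r) (hP : P ⊆ indSets (Finset.univ.erase i) (r - 1))
    (hQ : Q ⊆ indSets (Finset.univ.erase i) (r - 1)) (hPne : P.Nonempty) (hQne : Q.Nonempty)
    (h : CrossIntersecting P Q)
    (hL : L ∈ indSets (Finset.univ.erase c) (min r (Fintype.card ι - 1))) :
    P.card + Q.card ≤ (linkFamily r c L).card + 1 := by
  obtain ⟨o⟩ : Nonempty κ := Fintype.card_pos_iff.1 (by omega)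
  obtain ⟨H, hH, hHcard⟩ := Finset.exists_subset_card_eq
    (s := Finset.univ.erase i) (n := min r (Fintype.card ι - 1)) (by rw [card_univ_erase]; omega)
  obtain ⟨H', hH', hHcard'⟩ := Finset.exists_subset_card_eq (s := H) (n := r - 1) (by omega)
  have h1 := h.card_add_card_le_indSets o hk (hH'.trans hH) hHcard' hP hQ hPne hQne
  have h2 : (linkFamily r i (constSet o H)).card = (linkFamily r c L).card :=
    card_linkFamily_eq hr o (hHcard ▸ constSet_mem_indSets o hH) hL
  rw [← h2, ← filter_trace_eq_linkFamily]
  refine h1.trans (Nat.add_le_add_right (Finset.card_le_card fun Y hY => ?_) 1)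
  rw [Finset.mem_filter] at hY ⊢
  exact ⟨hY.1, hY.2.mono (Finset.inter_subset_inter_left hH')⟩

/-- For `r < n` there is room for an additional vertex: two of the sets through it that meet the
larger set `H` do not meet the smaller one. -/
lemma card_add_card_lt_linkFamily (hk : 2 ≤ Fintype.card κ) (hrn : r < Fintype.card ι)
    (hr : 3 ≤ r) (hP : P ⊆ indSets (Finset.univ.erase i) (r - 1))
    (hQ : Q ⊆ indSets (Finset.univ.erase i) (r - 1)) (hPne : P.Nonempty) (hQne : Q.Nonempty)
    (h : CrossIntersecting P Q)
    (hL : L ∈ indSets (Finset.univ.erase c) (min r (Fintype.card ι - 1))) :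
    P.card + Q.card < (linkFamily r c L).card := by
  obtain ⟨o⟩ : Nonempty κ := Fintype.card_pos_iff.1 (by omega)
  obtain ⟨l, hl⟩ := exists_ne_label hk o
  obtain ⟨H, hH, hHcard⟩ := Finset.exists_subset_card_eq
    (s := Finset.univ.erase i) (n := min r (Fintype.card ι - 1)) (by rw [card_univ_erase]; omega)
  obtain ⟨H', hH', hHcard'⟩ := Finset.exists_subset_card_eq (s := H) (n := r - 1) (by omega)
  have h1 := h.card_add_card_le_indSets o hk (hH'.trans hH) hHcard' hP hQ hPne hQne
  have h2 : (linkFamily r i (constSet o H)).card = (linkFamily r c L).card :=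
    card_linkFamily_eq (by omega) o (hHcard ▸ constSet_mem_indSets o hH) hL
  rw [← h2, ← filter_trace_eq_linkFamily]
  obtain ⟨e, heH, heH'⟩ : ∃ e ∈ H, e ∉ H' := Finset.exists_mem_notMem_of_card_lt_card (by omega)
  obtain ⟨y, hy, y', hy', hyy'⟩ := Finset.one_lt_card.1 (show 1 < H'.card by omega)
  have hX : ∀ y ∈ H', insert (e, o) (constSet l (H'.erase y)) ∈
      indSets (Finset.univ.erase i) (r - 1) ∧
      trace o (insert (e, o) (constSet l (H'.erase y))) = {e} := by
    intro y hy
    refine ⟨(insert_mem_indSets (by omega) (hH heH) (?_ : _ ∈ indSets _ (r - 1 - 1)) o).1, ?_⟩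
    · have : (H'.erase y).card = r - 1 - 1 := by rw [Finset.card_erase_of_mem hy, hHcard']
      rw [← this]
      refine constSet_mem_indSets l fun z hz => Finset.mem_erase.2 ⟨?_, ?_⟩
      · rintro rfl
        exact heH' (Finset.mem_of_mem_erase hz)
      · exact hH (hH' (Finset.mem_of_mem_erase hz))
    · ext z
      simp only [mem_trace, Finset.mem_insert, mem_constSet, Finset.mem_singleton, Prod.mk.injEq,
        and_true, hl.symm, and_false, or_false]
  have hne : insert (e, o) (constSet l (H'.erase y)) ≠
      insert (e, o) (constSet l (H'.erase y')) := by
    intro heq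
    have : (y', l) ∈ insert (e, o) (constSet l (H'.erase y)) :=
      Finset.mem_insert_of_mem (mem_constSet.2 ⟨Finset.mem_erase.2 ⟨hyy'.symm, hy'⟩, rfl⟩)
    rw [heq, Finset.mem_insert, mem_constSet] at this
    rcases this with h | h
    · exact hl (congrArg Prod.snd h)
    · exact Finset.notMem_erase _ _ h.1
  have hsub : ((indSets (Finset.univ.erase i) (r - 1)).filter fun Y : Finset (ι × κ) =>
      (trace o Y ∩ H').Nonempty) ∪ {insert (e, o) (constSet l (H'.erase y)),
        insert (e, o) (constSet l (H'.erase y'))} ⊆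
      (indSets (Finset.univ.erase i) (r - 1)).filter fun Y => (trace o Y ∩ H).Nonempty := by
    have hmem : ∀ y ∈ H', insert (e, o) (constSet l (H'.erase y)) ∈
        (indSets (Finset.univ.erase i) (r - 1)).filter fun Y => (trace o Y ∩ H).Nonempty :=
      fun y hy => by
        rw [Finset.mem_filter, (hX y hy).2]
        exact ⟨(hX y hy).1, e, Finset.mem_inter.2 ⟨Finset.mem_singleton_self e, heH⟩⟩
    intro Y hY
    rw [Finset.mem_union, Finset.mem_insert, Finset.mem_singleton] at hY
    rcases hY with hY | rfl | rfl
    · rw [Finset.mem_filter] at hY ⊢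
      exact ⟨hY.1, hY.2.mono (Finset.inter_subset_inter_left hH')⟩
    · exact hmem y hy
    · exact hmem y' hy'
  have hcard := Finset.card_le_card hsub
  rw [Finset.card_union_of_disjoint, Finset.card_pair hne] at hcard
  · omega
  · have hnot : ∀ y ∈ H', insert (e, o) (constSet l (H'.erase y)) ∉
        (indSets (Finset.univ.erase i) (r - 1)).filter fun Y => (trace o Y ∩ H').Nonempty :=
      fun y hy hcon => by
        rw [Finset.mem_filter, (hX y hy).2] at hcon
        obtain ⟨z, hz⟩ := hcon.2
        rw [Finset.mem_inter, Finset.mem_singleton] at hz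
        exact heH' (hz.1 ▸ hz.2)
    rw [Finset.disjoint_right]
    intro Y hY
    rw [Finset.mem_insert, Finset.mem_singleton] at hY
    rcases hY with rfl | rfl
    · exact hnot y hy
    · exact hnot y' hy'

end

/-- The members of an extremal family avoiding its centre are counted by a trace weight. -/
lemma card_extremal (hk : 2 ≤ Fintype.card κ) {r : ℕ} (hr : 1 ≤ r) {v : ι × κ}
    {L : Finset (ι × κ)}
    (hL : L ∈ indSets (Finset.univ.erase v.1) (min r (Fintype.card ι - 1))) :
    (extremal r v L).card = (linkFamily r v.1 L).card +
      traceWeight (Fintype.card ι) r (Fintype.card κ) (min r (Fintype.card ι - 1)) := by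
  obtain ⟨o⟩ : Nonempty κ := Fintype.card_pos_iff.1 (by omega)
  obtain ⟨H, hH, hHcard⟩ := Finset.exists_subset_card_eq
    (s := Finset.univ.erase v.1) (n := min r (Fintype.card ι - 1))
    (by rw [card_univ_erase]; omega)
  have hx : v.1 ∉ H := fun h => Finset.notMem_erase _ _ (hH h)
  have hLH : constSet o H ∈ indSets (Finset.univ.erase v.1) (min r (Fintype.card ι - 1)) :=
    hHcard ▸ constSet_mem_indSets o hH
  rw [card_extremal_eq (v' := (v.1, o)) hL hLH, card_linkFamily_eq hr o hL hLH,
    ← memberSubfamily_extremal (v := (v.1, o)) hr hLH,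
    ← Finset.card_memberSubfamily_add_card_nonMemberSubfamily (v.1, o), ← hHcard,
    ← Finset.card_univ, ← card_filter_trace_eq o (Finset.subset_univ H)]
  congr 2
  ext X
  rw [Finset.mem_nonMemberSubfamily, mem_extremal_constSet hx hHcard, mem_extTraces,
    Finset.mem_filter, and_assoc]
  refine and_congr_right fun _ => ?_
  rw [← mem_trace (o := o)]
  constructor
  · rintro ⟨h1 | h1, h2⟩
    · exact absurd h1.1 h2
    · exact h1
  · rintro h
    exact ⟨Or.inr h, h ▸ hx⟩

end Links

/-! ### Recognizing extremal families -/

section Recognition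

variable {ι κ : Type*} [Fintype ι] [DecidableEq ι] [Fintype κ] [DecidableEq κ]

lemma exists_indSets_superset (o : κ) {V : Finset ι} {s h : ℕ} (hsh : s ≤ h) (hV : h ≤ V.card)
    {L : Finset (ι × κ)} (hL : L ∈ indSets V s) : ∃ L' ∈ indSets V h, L ⊆ L' := by
  have hsub : L.image Prod.fst ⊆ V := fun i hi => by
    obtain ⟨p, hp, rfl⟩ := Finset.mem_image.1 hi
    exact (mem_indSets.1 hL).2.1 p hp
  obtain ⟨S, hLS, hSV, hS⟩ := Finset.exists_subsuperset_card_eq hsub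
    (by rwa [card_image_fst hL]) hV
  have hL' := mem_indSets.1 hL
  have hdis : ∀ p ∈ L, ∀ q ∈ constSet o (S \ L.image Prod.fst), p.1 ≠ q.1 := fun p hp q hq hpq =>
    (Finset.mem_sdiff.1 (mem_constSet.1 hq).1).2 (hpq ▸ Finset.mem_image_of_mem _ hp)
  refine ⟨L ∪ constSet o (S \ L.image Prod.fst), mem_indSets.2 ⟨?_, fun p hp => ?_,
    fun p hp q hq hpq => ?_⟩, Finset.subset_union_left⟩
  · rw [Finset.card_union_of_disjoint, hL'.1,
      (mem_indSets.1 (constSet_mem_indSets o (Finset.Subset.refl _))).1,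
      Finset.card_sdiff_of_subset hLS, card_image_fst hL, hS]
    · omega
    · exact Finset.disjoint_left.2 fun p hp hq => hdis p hp p hq rfl
  · rcases Finset.mem_union.1 hp with hp | hp
    · exact hL'.2.1 p hp
    · exact hSV (Finset.mem_sdiff.1 (mem_constSet.1 hp).1).1
  · rcases Finset.mem_union.1 hp with hp | hp <;> rcases Finset.mem_union.1 hq with hq | hq
    · exact hL'.2.2 p hp q hq hpq
    · exact absurd hpq (hdis p hp q hq)
    · exact absurd hpq.symm (hdis q hq p hp)
    · exact Prod.ext hpq ((mem_constSet.1 hp).2.trans (mem_constSet.1 hq).2.symm)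

/-- With two labels available, an independent set through a given vertex can avoid a given
independent set not containing that vertex. -/
lemma exists_indSets_mem_disjoint (hk : 2 ≤ Fintype.card κ) {V W : Finset ι} {s t : ℕ}
    (hs : 1 ≤ s) (hsV : s ≤ V.card) {L : Finset (ι × κ)} (hL : L ∈ indSets W t) {e : ι × κ}
    (heV : e.1 ∈ V) (heL : e ∉ L) : ∃ Y ∈ indSets V s, e ∈ Y ∧ ¬ (Y ∩ L).Nonempty := by
  have hlab : ∀ b : ι, ∃ l, (b, l) ∉ L := fun b => by
    by_contra hcon
    push Not at hcon
    obtain ⟨l, hl⟩ := exists_ne_label hk e.2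
    exact hl (eq_label_of_mem hL (hcon l) (hcon e.2))
  choose g hg using hlab
  obtain ⟨S, heS, hSV, hS⟩ := Finset.exists_subsuperset_card_eq
    (Finset.singleton_subset_iff.2 heV) (by rwa [Finset.card_singleton]) hsV
  have heS' : e.1 ∈ S := heS (Finset.mem_singleton_self _)
  refine ⟨S.image fun b => (b, if b = e.1 then e.2 else g b), hS ▸ graph_mem_indSets _ hSV,
    Finset.mem_image.2 ⟨e.1, heS', by simp⟩, ?_⟩
  rintro ⟨z, hz⟩
  obtain ⟨hz, hzL⟩ := Finset.mem_inter.1 hz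
  obtain ⟨b, _, rfl⟩ := Finset.mem_image.1 hz
  split_ifs at hzL with hb
  · exact heL (by rw [hb] at hzL; exact hzL)
  · exact hg b hzL

/-- A family of the extremal size is extremal if sufficiently many of its members contain `v`:
they then form all of the sets through `v` meeting a set `L`, which every other member must
contain. -/
lemma eq_extremal_of_card_le (hk : 2 ≤ Fintype.card κ) {r : ℕ} (hr : 2 ≤ r)
    (hrn : r ≤ Fintype.card ι) {F : Finset (Finset (ι × κ))} (hF : F ⊆ indSets Finset.univ r)
    (h : CrossIntersecting F F) (hnt : Nontriv F) {v v' : ι × κ} {L' : Finset (ι × κ)}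
    (hL' : L' ∈ indSets (Finset.univ.erase v'.1) (min r (Fintype.card ι - 1)))
    (hcard : F.card = (extremal r v' L').card)
    (hv : (linkFamily r v'.1 L').card ≤ (F.memberSubfamily v).card) :
    ∃ L ∈ indSets (Finset.univ.erase v.1) (min r (Fintype.card ι - 1)), F = extremal r v L := by
  have key : ∀ X ∈ F, v ∉ X → ∃ L ∈ indSets (Finset.univ.erase v.1) (min r (Fintype.card ι - 1)),
      L ⊆ X ∧ F.memberSubfamily v = linkFamily r v.1 L := by
    intro X hX hvX
    set L := X.filter fun p => p.1 ≠ v.1 with hLdef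
    have hX' := mem_indSets.1 (hF hX)
    have hL : L ∈ indSets (Finset.univ.erase v.1) L.card := by
      refine mem_indSets.2 ⟨rfl, fun p hp => ?_, fun p hp q hq => ?_⟩
      · exact Finset.mem_erase.2 ⟨(Finset.mem_filter.1 hp).2, Finset.mem_univ _⟩
      · exact hX'.2.2 p (Finset.mem_filter.1 hp).1 q (Finset.mem_filter.1 hq).1
    have hLr : L.card ≤ r := hX'.1 ▸ Finset.card_filter_le _ _
    have hLn : L.card ≤ Fintype.card ι - 1 := by
      rw [← card_image_fst hL]
      refine card_le_of_notMem (x := v.1) fun hcon => ?_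
      obtain ⟨p, hp, hpv⟩ := Finset.mem_image.1 hcon
      exact (Finset.mem_filter.1 hp).2 hpv
    obtain ⟨M, hM, hLM⟩ := exists_indSets_superset v.2
      (show L.card ≤ min r (Fintype.card ι - 1) from le_min hLr hLn)
      (by rw [card_univ_erase]; omega) hL
    have hmeet : ∀ Y ∈ F.memberSubfamily v, (Y ∩ L).Nonempty := by
      intro Y hY
      have hY' := memberSubfamily_subset_indSets hF hY
      rw [Finset.mem_memberSubfamily] at hY
      obtain ⟨z, hz⟩ := h _ hY.1 X hX
      rw [Finset.mem_inter, Finset.mem_insert] at hz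
      rcases hz with ⟨rfl | hzY, hzX⟩
      · exact absurd hzX hvX
      · exact ⟨z, Finset.mem_inter.2 ⟨hzY, Finset.mem_filter.2 ⟨hzX,
          Finset.ne_of_mem_erase ((mem_indSets.1 hY').2.1 z hzY)⟩⟩⟩
    have hsub : F.memberSubfamily v ⊆ linkFamily r v.1 M := fun Y hY =>
      Finset.mem_filter.2 ⟨memberSubfamily_subset_indSets hF hY,
        (hmeet Y hY).mono (Finset.inter_subset_inter_left hLM)⟩
    have heq : F.memberSubfamily v = linkFamily r v.1 M := by
      refine Finset.eq_of_subset_of_card_le hsub ?_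
      rwa [card_linkFamily_eq (by omega) v.2 hM hL']
    have hML : M ⊆ L := by
      intro e he
      by_contra heL
      obtain ⟨Y, hY, heY, hYL⟩ := exists_indSets_mem_disjoint hk (V := Finset.univ.erase v.1)
        (s := r - 1) (by omega) (by rw [card_univ_erase]; omega) hL
        ((mem_indSets.1 hM).2.1 e he) heL
      refine hYL (hmeet Y ?_)
      rw [heq]
      exact Finset.mem_filter.2 ⟨hY, e, Finset.mem_inter.2 ⟨heY, he⟩⟩
    exact ⟨M, hM, hML.trans (Finset.filter_subset _ _), heq⟩
  obtain ⟨X, hX, hvX⟩ := hnt v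
  obtain ⟨L, hL, -, heq⟩ := key X hX hvX
  refine ⟨L, hL, Finset.eq_of_subset_of_card_le (fun Z hZ => ?_) ?_⟩
  · refine Finset.mem_filter.2 ⟨hF hZ, ?_⟩
    by_cases hvZ : v ∈ Z
    · have : Z.erase v ∈ linkFamily r v.1 L := by
        rw [← heq, Finset.mem_memberSubfamily, Finset.insert_erase hvZ]
        exact ⟨hZ, Finset.notMem_erase _ _⟩
      exact Or.inl ⟨hvZ, (Finset.mem_filter.1 this).2.mono
        (Finset.inter_subset_inter_right (Finset.erase_subset _ _))⟩
    · obtain ⟨M, hM, hMZ, heq'⟩ := key Z hZ hvZ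
      refine Or.inr ⟨hvZ, fun e he => hMZ ?_⟩
      by_contra heM
      obtain ⟨Y, hY, heY, hYM⟩ := exists_indSets_mem_disjoint hk (V := Finset.univ.erase v.1)
        (s := r - 1) (by omega) (by rw [card_univ_erase]; omega) hM
        ((mem_indSets.1 hL).2.1 e he) heM
      have : Y ∈ linkFamily r v.1 M := by
        rw [← heq', heq]
        exact Finset.mem_filter.2 ⟨hY, e, Finset.mem_inter.2 ⟨heY, he⟩⟩
      exact hYM (Finset.mem_filter.1 this).2
  · rw [hcard, card_extremal_eq hL hL']

lemma nonMemberSubfamily_shift {α : Type*} [DecidableEq α] {x y v : α} (hxy : x ≠ y)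
    (hvx : v ≠ x) (hvy : v ≠ y) (A : Finset (Finset α)) :
    (shift x y A).nonMemberSubfamily v = shift x y (A.nonMemberSubfamily v) := by
  ext a
  simp only [Finset.mem_nonMemberSubfamily, mem_shift hxy, Finset.mem_insert, Finset.mem_erase,
    hvx, hvy, false_or, ne_eq, not_false_eq_true, true_and]
  tauto

lemma card_memberSubfamily_shift {α : Type*} [DecidableEq α] {x y v : α} (hxy : x ≠ y)
    (hvx : v ≠ x) (hvy : v ≠ y) (A : Finset (Finset α)) :
    ((shift x y A).memberSubfamily v).card = (A.memberSubfamily v).card := by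
  have h1 := Finset.card_memberSubfamily_add_card_nonMemberSubfamily v A
  have h2 := Finset.card_memberSubfamily_add_card_nonMemberSubfamily v (shift x y A)
  rw [nonMemberSubfamily_shift hxy hvx hvy, card_shift, card_shift] at h2
  omega

end Recognition

/-! ### Undoing a shift, and the extremal problem -/

section Unshift

variable {ι κ : Type*} [Fintype ι] [DecidableEq ι] [Fintype κ] [DecidableEq κ]

/-- With three labels available, two transversals that avoid a given vertex have a transversal
through this vertex disjoint from both of them. -/
lemma exists_common_disjoint (hk : 3 ≤ Fintype.card κ) {V : Finset ι} {Y Z : Finset (ι × κ)}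
    (hY : Y ∈ indSets V V.card) (hZ : Z ∈ indSets V V.card) {q : ι × κ} (hqV : q.1 ∈ V)
    (hqY : q ∉ Y) (hqZ : q ∉ Z) :
    ∃ U ∈ indSets V V.card, q ∈ U ∧ ¬ (U ∩ Y).Nonempty ∧ ¬ (U ∩ Z).Nonempty := by
  have hlab : ∀ b : ι, ∃ l, (b, l) ∉ Y ∧ (b, l) ∉ Z := fun b => by
    by_contra hcon
    push Not at hcon
    have h1 : (Finset.univ.filter fun l => (b, l) ∈ Y).card ≤ 1 := Finset.card_le_one.2
      fun l hl l' hl' => eq_label_of_mem hY (Finset.mem_filter.1 hl).2 (Finset.mem_filter.1 hl').2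
    have h2 : (Finset.univ.filter fun l => (b, l) ∈ Z).card ≤ 1 := Finset.card_le_one.2
      fun l hl l' hl' => eq_label_of_mem hZ (Finset.mem_filter.1 hl).2 (Finset.mem_filter.1 hl').2
    have h3 := Finset.card_le_card (s := (Finset.univ : Finset κ))
      (t := (Finset.univ.filter fun l => (b, l) ∈ Y) ∪ Finset.univ.filter fun l => (b, l) ∈ Z)
      fun l _ => by
        rw [Finset.mem_union, Finset.mem_filter, Finset.mem_filter]
        by_cases hl : (b, l) ∈ Y
        · exact Or.inl ⟨Finset.mem_univ _, hl⟩
        · exact Or.inr ⟨Finset.mem_univ _, hcon l hl⟩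
    have h4 := Finset.card_union_le (Finset.univ.filter fun l => (b, l) ∈ Y)
      (Finset.univ.filter fun l => (b, l) ∈ Z)
    rw [Finset.card_univ] at h3
    omega
  choose g hg using hlab
  have hdis : ∀ W : Finset (ι × κ), q ∉ W → (∀ b, (b, g b) ∉ W) →
      ¬ ((V.image fun b => (b, if b = q.1 then q.2 else g b)) ∩ W).Nonempty := by
    rintro W hqW hgW ⟨z, hz⟩
    obtain ⟨hz, hzW⟩ := Finset.mem_inter.1 hz
    obtain ⟨b, _, rfl⟩ := Finset.mem_image.1 hz
    split_ifs at hzW with hb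
    · exact hqW (by rw [hb] at hzW; exact hzW)
    · exact hgW b hzW
  exact ⟨V.image fun b => (b, if b = q.1 then q.2 else g b), graph_mem_indSets _ subset_rfl,
    Finset.mem_image.2 ⟨q.1, hqV, by simp⟩, hdis Y hqY fun b => (hg b).1,
    hdis Z hqZ fun b => (hg b).2⟩

/-- A transversal meeting the transversal `L` in a given vertex only. -/
lemma exists_inter_eq_singleton (hk : 2 ≤ Fintype.card κ) {V : Finset ι} {L : Finset (ι × κ)}
    (hL : L ∈ indSets V V.card) {p : ι × κ} (hp : p ∈ L) :
    ∃ U ∈ indSets V V.card, p ∈ U ∧ ∀ q ∈ L, q ≠ p → q ∉ U := by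
  have hlab : ∀ b : ι, ∃ l, (b, l) ∉ L := fun b => by
    by_contra hcon
    push Not at hcon
    obtain ⟨l, hl⟩ := exists_ne_label hk p.2
    exact hl (eq_label_of_mem hL (hcon l) (hcon p.2))
  choose g hg using hlab
  refine ⟨V.image fun b => (b, if b = p.1 then p.2 else g b), graph_mem_indSets _ subset_rfl,
    Finset.mem_image.2 ⟨p.1, (mem_indSets.1 hL).2.1 p hp, by simp⟩, fun q hq hqp hqU => ?_⟩
  obtain ⟨b, _, rfl⟩ := Finset.mem_image.1 hqU
  split_ifs at hq hqp with hb
  · exact hqp (by rw [hb])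
  · exact hg b hq

/-- The transversals meeting the transversal `L`, other than `L` itself, form a connected graph if
disjoint transversals are joined: `N` is thought of as a connected component. -/
lemma forall_of_disjoint_closed (hk : 3 ≤ Fintype.card κ) {V : Finset ι} (hV : 3 ≤ V.card)
    {L : Finset (ι × κ)} (hL : L ∈ indSets V V.card) {N : Finset (ι × κ) → Prop}
    (hN : ∀ W ∈ indSets V V.card, ∀ U ∈ indSets V V.card, (U ∩ L).Nonempty → N W →
      ¬ (U ∩ W).Nonempty → N U)
    {Y Z : Finset (ι × κ)} (hY : Y ∈ indSets V V.card) (hZ : Z ∈ indSets V V.card)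
    (hYL : (Y ∩ L).Nonempty) (hZL : (Z ∩ L).Nonempty) (hYne : Y ≠ L) (hZne : Z ≠ L) (hNY : N Y) :
    N Z := by
  have hLV := (mem_indSets.1 hL).2.1
  have step : ∀ W ∈ indSets V V.card, ∀ W' ∈ indSets V V.card, (W' ∩ L).Nonempty → N W →
      ∀ q ∈ L, q ∉ W → q ∉ W' → N W' := by
    intro W hW W' hW' hW'L hNW q hq hqW hqW'
    obtain ⟨U, hU, hqU, hUW, hUW'⟩ := exists_common_disjoint hk hW hW' (hLV q hq) hqW hqW'
    refine hN U hU W' hW' hW'L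
      (hN W hW U hU ⟨q, Finset.mem_inter.2 ⟨hqU, hq⟩⟩ hNW hUW) ?_
    rwa [Finset.inter_comm]
  have hmiss : ∀ W ∈ indSets V V.card, W ≠ L → ∃ q ∈ L, q ∉ W := fun W hW hne => by
    by_contra hcon
    push Not at hcon
    refine hne (Finset.eq_of_subset_of_card_le hcon ?_).symm
    rw [(mem_indSets.1 hW).1, (mem_indSets.1 hL).1]
  obtain ⟨p, hp⟩ := hYL
  obtain ⟨p', hp'⟩ := id hZL
  rw [Finset.mem_inter] at hp hp'
  obtain ⟨q, hq, hqY⟩ := hmiss Y hY hYne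
  obtain ⟨q', hq', hqZ⟩ := hmiss Z hZ hZne
  obtain ⟨Y1, hY1, hpY1, hY1L⟩ := exists_inter_eq_singleton (by omega) hL hp.2
  obtain ⟨Z1, hZ1, hpZ1, hZ1L⟩ := exists_inter_eq_singleton (by omega) hL hp'.2
  obtain ⟨t, ht, htp⟩ : ∃ t ∈ L, t ∉ ({p, p'} : Finset (ι × κ)) :=
    Finset.exists_mem_notMem_of_card_lt_card (by
      have := Finset.card_le_two (a := p) (b := p')
      rw [(mem_indSets.1 hL).1]
      omega)
  rw [Finset.mem_insert, Finset.mem_singleton, not_or] at htp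
  have hNY1 := step Y hY Y1 hY1 ⟨p, Finset.mem_inter.2 ⟨hpY1, hp.2⟩⟩ hNY q hq hqY
    (hY1L q hq (by rintro rfl; exact hqY hp.1))
  have hNZ1 := step Y1 hY1 Z1 hZ1 ⟨p', Finset.mem_inter.2 ⟨hpZ1, hp'.2⟩⟩ hNY1 t ht
    (hY1L t ht htp.1) (hZ1L t ht htp.2)
  exact step Z1 hZ1 Z hZ hZL hNZ1 q' hq'
    (hZ1L q' hq' (by rintro rfl; exact hqZ hp'.1)) hqZ

/-- A nontrivial intersecting family with an extremal shift is extremal. The delicate case is that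
of a shift to the centre: the links at the two vertices of the shift then cover the link of the
extremal family, and one of them is everything. -/
lemma exists_eq_extremal_of_shift {o j : κ} {i : ι} (hj : j ≠ o) {r : ℕ} (hr : 3 ≤ r)
    (hrn : r ≤ Fintype.card ι) (hk : 2 ≤ Fintype.card κ)
    (hcond : r < Fintype.card ι ∨ (r = Fintype.card ι ∧ 4 ≤ Fintype.card ι ∧ 3 ≤ Fintype.card κ))
    {F : Finset (Finset (ι × κ))} (hF : F ⊆ indSets Finset.univ r) (h : CrossIntersecting F F)
    (hnt : Nontriv F) {v : ι × κ} {L : Finset (ι × κ)}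
    (hL : L ∈ indSets (Finset.univ.erase v.1) (min r (Fintype.card ι - 1)))
    (hshift : shift (i, o) (i, j) F = extremal r v L) :
    ∃ v' L', L' ∈ indSets (Finset.univ.erase v'.1) (min r (Fintype.card ι - 1)) ∧
      F = extremal r v' L' := by
  have hne := pair_ne_pair hj i
  have hcard : F.card = (extremal r v L).card := by rw [← hshift, card_shift]
  have hlink := memberSubfamily_extremal (by omega) hL (r := r)
  rw [← hshift] at hlink
  by_cases hvy : v = (i, j)
  · -- members of the shifted family through `(i, j)` have not been moved
    subst hvy
    obtain ⟨L', hL', hF'⟩ := eq_extremal_of_card_le hk (by omega) hrn hF h hnt hL hcard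
      (v := (i, j)) (by
        rw [← hlink]
        refine Finset.card_le_card fun Y hY => ?_
        rw [Finset.mem_memberSubfamily, mem_shift hne] at hY
        rw [Finset.mem_memberSubfamily]
        refine ⟨?_, hY.2⟩
        rcases hY.1 with hY' | hY'
        · exact hY'.1
        · exact absurd (Finset.mem_insert_self _ _) hY'.2.2.1)
    exact ⟨_, L', hL', hF'⟩
  by_cases hvx : v = (i, o)
  swap
  · obtain ⟨L', hL', hF'⟩ := eq_extremal_of_card_le hk (by omega) hrn hF h hnt hL hcard
      (v := v) (by rw [← hlink, card_memberSubfamily_shift hne hvx hvy])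
    exact ⟨_, L', hL', hF'⟩
  subst hvx
  have hcover : linkFamily r i L ⊆ F.memberSubfamily (i, o) ∪ F.memberSubfamily (i, j) := by
    intro Y hY
    have hY' := (insert_mem_indSets (by omega) (Finset.mem_univ i) (Finset.mem_filter.1 hY).1 j).2
    have hYs : Y ∈ (shift (i, o) (i, j) F).memberSubfamily (i, o) := hlink ▸ hY
    rw [Finset.mem_memberSubfamily, mem_shift hne] at hYs
    rw [Finset.mem_union, Finset.mem_memberSubfamily, Finset.mem_memberSubfamily]
    rcases hYs.1 with h1 | h1
    · exact Or.inl ⟨h1.1, hYs.2⟩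
    · rw [Finset.erase_insert hYs.2] at h1
      exact Or.inr ⟨h1.2.2.2, hY'⟩
  by_cases hP : linkFamily r i L ⊆ F.memberSubfamily (i, o)
  · obtain ⟨L', hL', hF'⟩ := eq_extremal_of_card_le hk (by omega) hrn hF h hnt hL hcard
      (v := (i, o)) (Finset.card_le_card hP)
    exact ⟨_, L', hL', hF'⟩
  by_cases hQ : linkFamily r i L ⊆ F.memberSubfamily (i, j)
  · obtain ⟨L', hL', hF'⟩ := eq_extremal_of_card_le hk (by omega) hrn hF h hnt hL hcard
      (v := (i, j)) (Finset.card_le_card hQ)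
    exact ⟨_, L', hL', hF'⟩
  exfalso
  obtain ⟨Y, hY, hYP⟩ := Finset.not_subset.1 hP
  obtain ⟨Z, hZ, hZQ⟩ := Finset.not_subset.1 hQ
  have hYQ := (Finset.mem_union.1 (hcover hY)).resolve_left hYP
  have hZP := (Finset.mem_union.1 (hcover hZ)).resolve_right hZQ
  have hcross := h.links_indSets hF hj.symm (i := i)
  rcases hcond with hlt | ⟨rfl, hn, hk3⟩
  · have h1 := card_add_card_lt_linkFamily hk hlt hr
      (memberSubfamily_subset_indSets (v := (i, o)) hF)
      (memberSubfamily_subset_indSets (v := (i, j)) hF) ⟨Z, hZP⟩ ⟨Y, hYQ⟩ hcross hL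
    have h2 := (Finset.card_le_card hcover).trans (Finset.card_union_le _ _)
    exact absurd (h2.trans_lt h1) (lt_irrefl _)
  · have hVcard : (Finset.univ.erase i).card = Fintype.card ι - 1 := card_univ_erase i
    -- the set `L` lies in both links, as `insert (i, j) L` is in the shifted family
    have hLV : L ∈ indSets (Finset.univ.erase i) (Fintype.card ι - 1) := by
      rwa [min_eq_right (by omega)] at hL
    have hLj := insert_mem_indSets (r := Fintype.card ι) (by omega) (Finset.mem_univ i) hLV j
    have hLo := insert_mem_indSets (r := Fintype.card ι) (by omega) (Finset.mem_univ i) hLV o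
    have hLmem : insert (i, j) L ∈ shift (i, o) (i, j) F := by
      rw [hshift]
      refine Finset.mem_filter.2 ⟨hLj.1, Or.inr ⟨?_, Finset.subset_insert _ _⟩⟩
      rw [Finset.mem_insert, not_or]
      exact ⟨hne, hLo.2⟩
    have hLF : insert (i, j) L ∈ F ∧ insert (i, o) L ∈ F := by
      rw [mem_shift hne] at hLmem
      rcases hLmem with h1 | h1
      · have := h1.2 (Finset.mem_insert_self _ _) (by
          rw [Finset.mem_insert, not_or]; exact ⟨hne, hLo.2⟩)
        rw [Finset.erase_insert hLj.2] at this
        exact ⟨h1.1, this⟩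
      · exact absurd (Finset.mem_insert_self _ _) h1.2.2.1
    have hYne : Y ≠ L := by
      rintro rfl
      exact hYP (Finset.mem_memberSubfamily.2 ⟨hLF.2, hLo.2⟩)
    have hZne : Z ≠ L := by
      rintro rfl
      exact hZQ (Finset.mem_memberSubfamily.2 ⟨hLF.1, hLj.2⟩)
    rw [← hVcard] at hLV
    have hmem : ∀ W, W ∈ linkFamily (Fintype.card ι) i L ↔
        W ∈ indSets (Finset.univ.erase i) (Finset.univ.erase i).card ∧ (W ∩ L).Nonempty := by
      intro W
      rw [linkFamily, Finset.mem_filter, hVcard]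
    have hfin := forall_of_disjoint_closed hk3 (by omega) hLV
      (N := fun W => W ∈ linkFamily (Fintype.card ι) i L ∧ W ∉ F.memberSubfamily (i, o))
      (fun W _ U hU hUL hNW hUW => by
        refine ⟨(hmem U).2 ⟨hU, hUL⟩, fun hUP => hUW ?_⟩
        exact hcross U hUP W ((Finset.mem_union.1 (hcover hNW.1)).resolve_left hNW.2))
      ((hmem Y).1 hY).1 ((hmem Z).1 hZ).1 ((hmem Y).1 hY).2 ((hmem Z).1 hZ).2 hYne hZne ⟨hY, hYP⟩
    exact hfin.2 hZP

/-- The bound and the uniqueness of the extremal families, for an arbitrary reference family. -/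
theorem card_le_card_extremal (o : κ) {r : ℕ} (hr : 3 ≤ r) (hrn : r ≤ Fintype.card ι)
    (hk : 2 ≤ Fintype.card κ) {v : ι × κ} {L : Finset (ι × κ)}
    (hL : L ∈ indSets (Finset.univ.erase v.1) (min r (Fintype.card ι - 1)))
    {F : Finset (Finset (ι × κ))} (hF : F ⊆ indSets Finset.univ r) (h : CrossIntersecting F F)
    (hnt : Nontriv F) :
    F.card ≤ (extremal r v L).card ∧
      ((4 ≤ r ∧ r < Fintype.card ι) ∨
          (r = Fintype.card ι ∧ 5 ≤ Fintype.card ι ∧ 3 ≤ Fintype.card κ) →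
        F.card = (extremal r v L).card →
        ∃ v' L', L' ∈ indSets (Finset.univ.erase v'.1) (min r (Fintype.card ι - 1)) ∧
          F = extremal r v' L') := by
  induction hN : totalWeight (labelWeight o) F using Nat.strong_induction_on generalizing F with
  | _ N ih =>
  by_cases hsh : ∀ i j, j ≠ o → shift (i, o) (i, j) F = F
  swap
  · push Not at hsh
    obtain ⟨i, j, hj, hne⟩ := hsh
    have hxy := pair_ne_pair hj i
    by_cases hnt' : Nontriv (shift (i, o) (i, j) F)
    · have hlt := totalWeight_shift_lt (labelWeight_lt (ι := ι) hj i) hne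
      have := ih _ (hN ▸ hlt) (shift_subset_indSets hj hF) (crossIntersecting_shift hxy h) hnt' rfl
      rw [card_shift] at this
      refine ⟨this.1, fun hcond hcard => ?_⟩
      obtain ⟨v', L', hL', hshift⟩ := this.2 hcond hcard
      exact exists_eq_extremal_of_shift hj hr hrn hk (by omega) hF h hnt hL' hshift
    · have hor := mem_or_mem_of_not_nontriv_shift hxy hnt hnt'
      have h1 := card_le_of_mem_or_mem hor
      have hnP : (F.memberSubfamily (i, o)).Nonempty := by
        obtain ⟨X, hX, hjX⟩ := hnt (i, j)
        have hoX := (hor X hX).resolve_right hjX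
        exact ⟨X.erase (i, o), Finset.mem_memberSubfamily.2
          ⟨by rwa [Finset.insert_erase hoX], Finset.notMem_erase _ _⟩⟩
      have hnQ : (F.memberSubfamily (i, j)).Nonempty := by
        obtain ⟨X, hX, hoX⟩ := hnt (i, o)
        have hjX := (hor X hX).resolve_left hoX
        exact ⟨X.erase (i, j), Finset.mem_memberSubfamily.2
          ⟨by rwa [Finset.insert_erase hjX], Finset.notMem_erase _ _⟩⟩
      have hcross := h.links_indSets hF hj.symm (i := i)
      have hE := card_extremal hk (by omega) hL
      rcases hrn.lt_or_eq with hlt | heq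
      · have := card_add_card_lt_linkFamily hk hlt hr
          (memberSubfamily_subset_indSets (v := (i, o)) hF)
          (memberSubfamily_subset_indSets (v := (i, j)) hF) hnP hnQ hcross hL
        exact ⟨by omega, fun _ hcard => absurd hcard (by omega)⟩
      · have := card_add_card_le_linkFamily hk hrn (by omega)
          (memberSubfamily_subset_indSets (v := (i, o)) hF)
          (memberSubfamily_subset_indSets (v := (i, j)) hF) hnP hnQ hcross hL
        have hw : traceWeight (Fintype.card ι) r (Fintype.card κ) (min r (Fintype.card ι - 1)) =
            Fintype.card κ - 1 := by
          rw [min_eq_right (by omega), ← heq, traceWeight, if_pos (by omega),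
            show r - (r - 1) = 1 by omega, Nat.choose_self, one_mul, pow_one]
        exact ⟨by omega, fun _ hcard => absurd hcard (by omega)⟩
  · -- all members meet in vertices labelled `o`, so that the traces can be compared
    have hGr : ∀ T ∈ F.image (trace o), T.card ≤ r := fun T hT => by
      obtain ⟨X, hX, rfl⟩ := Finset.mem_image.1 hT
      exact card_trace_le (hF hX)
    have hG : CrossIntersecting (F.image (trace o)) (F.image (trace o)) := by
      intro S hS T hT
      obtain ⟨X, hX, rfl⟩ := Finset.mem_image.1 hS
      obtain ⟨Y, hY, rfl⟩ := Finset.mem_image.1 hT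
      exact trace_inter_trace_nonempty hF hF h hsh hX hY
    have hGnt : Nontriv (F.image (trace o)) := fun x => by
      obtain ⟨X, hX, hxX⟩ := hnt (x, o)
      exact ⟨_, Finset.mem_image_of_mem _ hX, by rwa [mem_trace]⟩
    obtain ⟨H, hH, hHcard⟩ := Finset.exists_subset_card_eq
      (s := Finset.univ.erase v.1) (n := min r (Fintype.card ι - 1))
      (by rw [card_univ_erase]; omega)
    have hx : v.1 ∉ H := fun h => Finset.notMem_erase _ _ (hH h)
    have hLH : constSet o H ∈ indSets (Finset.univ.erase v.1) (min r (Fintype.card ι - 1)) :=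
      hHcard ▸ constSet_mem_indSets o hH
    have hcardE := card_extremal_constSet (r := r) o hx hHcard
    rw [card_extremal_eq (v := (v.1, o)) (v' := v) hLH hL] at hcardE
    have h1 := card_le_sum_traceWeight o hF
    rw [Finset.card_univ] at h1
    have h2 := sum_weight_nontriv_le hk hr hrn hx hHcard hGr hG hGnt
    refine ⟨by rw [hcardE]; exact h1.trans h2, fun hcond hcard => ?_⟩
    have h3 := card_le_card_pairs_of_sum_weight_le hk hr hrn hx hHcard (by omega)
      (traceWeight_sub_two_lt hk hrn (by omega)) hGr hG hGnt
      (by rw [← hcardE, ← hcard]; exact h1)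
    obtain ⟨x', H', hx', hH'card, hsub⟩ := exists_subset_extTraces (by omega) hG hGnt
      (fun x T hT hxT => by
        rw [hHcard]
        exact le_min (hGr T hT) (card_le_of_notMem hxT)) h3
    rw [hHcard] at hH'card
    have hLH' : constSet o H' ∈ indSets (Finset.univ.erase x') (min r (Fintype.card ι - 1)) :=
      hH'card ▸ constSet_mem_indSets o fun z hz => Finset.mem_erase.2
        ⟨by rintro rfl; exact hx' hz, Finset.mem_univ _⟩
    refine ⟨(x', o), constSet o H', hLH', Finset.eq_of_subset_of_card_le (fun X hX => ?_) ?_⟩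
    · exact (mem_extremal_constSet hx' hH'card).2
        ⟨hF hX, hsub (Finset.mem_image_of_mem _ hX)⟩
    · rw [hcard, card_extremal_eq (v := (x', o)) (v' := v) hLH' hL]

end Unshift

/-! ### The families of the theorem -/

section Families

lemma card_linkFamily_full {ι κ : Type*} [Fintype ι] [DecidableEq ι] [Fintype κ] [DecidableEq κ]
    (o : κ) {i : ι} {L : Finset (ι × κ)}
    (hn : 1 ≤ Fintype.card ι)
    (hL : L ∈ indSets (Finset.univ.erase i) (Fintype.card ι - 1)) :
    (linkFamily (Fintype.card ι) i L).card + (Fintype.card κ - 1) ^ (Fintype.card ι - 1) =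
      Fintype.card κ ^ (Fintype.card ι - 1) := by
  have hV : (Finset.univ.erase i).card = Fintype.card ι - 1 := card_univ_erase i
  rw [card_linkFamily_eq hn o hL (hV ▸ constSet_mem_indSets o subset_rfl)]
  have h1 := card_indSets_labels o (Finset.univ.erase i) (Fintype.card ι - 1)
    (Finset.univ : Finset κ)
  have h2 := card_indSets_labels o (Finset.univ.erase i) (Fintype.card ι - 1) ({o}ᶜ : Finset κ)
  rw [hV, Nat.choose_self, one_mul] at h1 h2
  rw [Finset.card_compl, Finset.card_singleton] at h2
  rw [Finset.card_univ, Finset.filter_true_of_mem fun _ _ _ _ => Finset.mem_univ _] at h1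
  rw [← h1, ← h2,
    ← Finset.card_filter_add_card_filter_not
      (s := indSets (Finset.univ.erase i) (Fintype.card ι - 1))
      (fun Y => (Y ∩ constSet o (Finset.univ.erase i)).Nonempty)]
  congr 2
  refine Finset.filter_congr fun Y hY => ?_
  constructor
  · rintro h ⟨z, hz⟩
    rw [Finset.mem_inter, mem_constSet] at hz
    simpa [hz.2.2] using h z hz.1
  · intro h p hp
    rw [Finset.mem_compl, Finset.mem_singleton]
    intro hpo
    exact h ⟨p, Finset.mem_inter.2 ⟨hp, mem_constSet.2 ⟨(mem_indSets.1 hY).2.1 p hp, hpo⟩⟩⟩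

lemma rIndepSets_eq_indSets (n k r : ℕ) : rIndepSets n k r = indSets Finset.univ r := by
  ext X
  rw [rIndepSets, Finset.mem_filter, mem_indSets, SimpleGraph.isNIndepSet_iff]
  simp only [Finset.mem_univ, true_and, implies_true]
  rw [and_comm]
  refine and_congr_right fun _ => ⟨fun h p hp q hq hpq => ?_, fun h p hp q hq hne hadj => ?_⟩
  · by_contra hne
    exact h hp hq hne ⟨hpq, fun h2 => hne (Prod.ext hpq h2)⟩
  · exact hne (h p hp q hq hadj.1)

/-- The automorphism of the graph given by a permutation preserving the cliques. -/
def PreservesCliques.iso {n k : ℕ} {σ : Equiv.Perm (Fin n × Fin k)} (h : PreservesCliques σ) :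
    cliqueUnion n k ≃g cliqueUnion n k where
  toEquiv := σ
  map_rel_iff' := by
    intro p q
    have key : ∀ p q : Fin n × Fin k, (cliqueUnion n k).Adj p q ↔ p.1 = q.1 ∧ p ≠ q :=
      fun p q => and_congr_right fun h1 => not_congr
        ⟨fun h2 => Prod.ext h1 h2, fun h2 => congrArg Prod.snd h2⟩
    rw [key, key, h p q, σ.injective.ne_iff]

lemma FamilyIso.card_eq {n k : ℕ} {F G : Finset (Finset (Fin n × Fin k))} (h : FamilyIso F G) :
    F.card = G.card := by
  obtain ⟨σ, rfl⟩ := h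
  exact (Finset.card_image_of_injective _ (Finset.image_injective σ.injective)).symm

lemma familyIso_extremal {n k r s : ℕ} {v v' : Fin n × Fin k} {L L' : Finset (Fin n × Fin k)}
    (hL : L ∈ indSets (Finset.univ.erase v.1) s) (hL' : L' ∈ indSets (Finset.univ.erase v'.1) s) :
    FamilyIso (extremal r v L) (extremal r v' L') := by
  obtain ⟨σ, hσ, rfl, rfl⟩ := exists_preservesCliques hL hL'
  exact ⟨hσ.iso, hσ.image_extremal r v L⟩

variable {n k : ℕ}

lemma firstVertices_eq_constSet (h0 : 0 < k) (r : ℕ) :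
    firstVertices n k r =
      constSet ⟨0, h0⟩ (Finset.univ.filter fun i : Fin n => 1 ≤ i.val ∧ i.val ≤ r) := by
  ext p
  simp [firstVertices, mem_constSet, Fin.ext_iff]

lemma firstVertices_mem_indSets (hn : 0 < n) (h0 : 0 < k) {h : ℕ} (hh : h ≤ n - 1) :
    firstVertices n k h ∈ indSets (Finset.univ.erase (⟨0, hn⟩ : Fin n)) h := by
  rw [firstVertices_eq_constSet h0]
  have hcard : (Finset.univ.filter fun i : Fin n => 1 ≤ i.val ∧ i.val ≤ h).card = h := by
    rw [← Finset.card_image_of_injective _ Fin.val_injective]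
    have : (Finset.univ.filter fun i : Fin n => 1 ≤ i.val ∧ i.val ≤ h).image Fin.val =
        Finset.Icc 1 h := by
      ext a
      simp only [Finset.mem_image, Finset.mem_filter, Finset.mem_univ, true_and, Finset.mem_Icc]
      constructor
      · rintro ⟨i, hi, rfl⟩
        exact hi
      · intro ha
        exact ⟨⟨a, by omega⟩, ha, rfl⟩
    rw [this, Nat.card_Icc, Nat.add_sub_cancel]
  have := constSet_mem_indSets (⟨0, h0⟩ : Fin k) (V := Finset.univ.erase (⟨0, hn⟩ : Fin n))
    (H := Finset.univ.filter fun i : Fin n => 1 ≤ i.val ∧ i.val ≤ h) (fun i hi => by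
      rw [Finset.mem_filter] at hi
      refine Finset.mem_erase.2 ⟨?_, Finset.mem_univ _⟩
      rintro rfl
      simp at hi)
  rwa [hcard] at this

lemma mem_ekrFamily (hn : 0 < n) (h0 : 0 < k) {r : ℕ} {X : Finset (Fin n × Fin k)} :
    X ∈ ekrFamily n k r ↔ X ∈ indSets Finset.univ r ∧ ((⟨0, hn⟩, ⟨0, h0⟩) : Fin n × Fin k) ∈ X := by
  rw [ekrFamily, Finset.mem_filter, rIndepSets_eq_indSets]
  refine and_congr_right fun _ => ⟨?_, fun h => ⟨_, h, rfl, rfl⟩⟩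
  rintro ⟨v, hv, h1, h2⟩
  rwa [show ((⟨0, hn⟩, ⟨0, h0⟩) : Fin n × Fin k) = v from
    Prod.ext (Fin.ext h1.symm) (Fin.ext h2.symm)]

lemma hmFamily_eq_extremal (hn : 0 < n) (h0 : 0 < k) {r : ℕ} (hr : r < n) :
    hmFamily n k r = extremal r (⟨0, hn⟩, ⟨0, h0⟩) (firstVertices n k r) := by
  have hL := firstVertices_mem_indSets hn h0 (show r ≤ n - 1 by omega)
  have hL' := mem_indSets.1 hL
  ext X
  rw [hmFamily, extremal, Finset.mem_union, Finset.mem_filter, Finset.mem_filter,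
    mem_ekrFamily hn h0, Finset.mem_singleton, and_or_left, and_assoc]
  refine or_congr_right ⟨?_, fun h => ?_⟩
  · rintro rfl
    exact ⟨mem_indSets.2 ⟨hL'.1, fun _ _ => Finset.mem_univ _, hL'.2.2⟩,
      notMem_of_mem_indSets_erase hL, subset_rfl⟩
  · refine (Finset.eq_of_subset_of_card_le h.2.2 ?_).symm
    rw [(mem_indSets.1 h.1).1, hL'.1]

lemma fullFamily_eq_extremal (hn : 0 < n) (h0 : 0 < k) :
    fullFamily n k = extremal n (⟨0, hn⟩, ⟨0, h0⟩) (firstVertices n k (n - 1)) := by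
  have hL := firstVertices_mem_indSets hn h0 (le_refl (n - 1))
  have hins : ∀ i : Fin k, (Finset.univ.filter fun v : Fin n × Fin k => v.1.val = 0 ∧ v.2 = i) ∪
      firstVertices n k (n - 1) = insert (⟨0, hn⟩, i) (firstVertices n k (n - 1)) := fun i => by
    rw [Finset.insert_eq]
    congr 1
    ext ⟨a, b⟩
    simp [Fin.ext_iff]
  ext X
  rw [fullFamily, extremal, Finset.mem_union, Finset.mem_filter, Finset.mem_filter,
    mem_ekrFamily hn h0, and_or_left, and_assoc]
  refine or_congr_right ?_
  rw [Finset.mem_image]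
  constructor
  · rintro ⟨i, hi, rfl⟩
    rw [hins]
    have h1 := insert_mem_indSets (by omega) (Finset.mem_univ _) hL i
    have h2 := insert_mem_indSets (by omega) (Finset.mem_univ _) hL ⟨0, h0⟩
    refine ⟨h1.1, ?_, Finset.subset_insert _ _⟩
    rw [Finset.mem_insert, not_or]
    refine ⟨fun heq => ?_, h2.2⟩
    have := congrArg (fun p : Fin n × Fin k => p.2.val) heq
    simp only at this
    have hi' := (Finset.mem_filter.1 hi).2
    omega
  · rintro ⟨hX, hvX, hLX⟩
    have hX' := mem_indSets.1 hX
    -- exactly one vertex of `X` is left, and it lies in the first clique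
    obtain ⟨p, hp⟩ := Finset.card_eq_one.1 (show (X \ firstVertices n k (n - 1)).card = 1 by
      rw [Finset.card_sdiff_of_subset hLX, hX'.1, (mem_indSets.1 hL).1]
      omega)
    have hXp : X = insert p (firstVertices n k (n - 1)) := by
      rw [Finset.insert_eq, ← hp, Finset.sdiff_union_of_subset hLX]
    have hpX : p ∈ X \ firstVertices n k (n - 1) := hp ▸ Finset.mem_singleton_self p
    rw [Finset.mem_sdiff] at hpX
    have hp0 : p.1 = ⟨0, hn⟩ := by
      by_contra hne
      have hpos : 1 ≤ p.1.val := by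
        by_contra h1
        exact hne (Fin.ext (show p.1.val = 0 by omega))
      have hq : (p.1, (⟨0, h0⟩ : Fin k)) ∈ firstVertices n k (n - 1) :=
        Finset.mem_filter.2 ⟨Finset.mem_univ _, ⟨hpos, by have := p.1.2; omega⟩, rfl⟩
      exact hpX.2 (hX'.2.2 _ (hLX hq) p hpX.1 rfl ▸ hq)
    have hpeq : p = (⟨0, hn⟩, p.2) := Prod.ext hp0 rfl
    refine ⟨p.2, Finset.mem_filter.2 ⟨Finset.mem_univ _, ?_⟩, ?_⟩
    · by_contra h1
      refine hvX ?_
      rw [show (⟨0, h0⟩ : Fin k) = p.2 from Fin.ext (show 0 = p.2.val by omega), ← hpeq]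
      exact hpX.1
    · rw [hins, ← hpeq, ← hXp]

lemma card_fullFamily (hn : 1 ≤ n) (hk : 2 ≤ k) :
    ((fullFamily n k).card : ℤ) = (k : ℤ) ^ (n - 1) - ((k : ℤ) - 1) ^ (n - 1) + (k : ℤ) - 1 := by
  have hL := firstVertices_mem_indSets (n := n) (k := k) (by omega) (by omega) (le_refl (n - 1))
  have h1 := card_extremal (ι := Fin n) (κ := Fin k) (by rwa [Fintype.card_fin]) hn
    (v := (⟨0, by omega⟩, ⟨0, by omega⟩)) (L := firstVertices n k (n - 1))
    (by rw [Fintype.card_fin, min_eq_right (by omega)]; exact hL)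
  have h2 := card_linkFamily_full (ι := Fin n) (κ := Fin k) ⟨0, by omega⟩
    (by rwa [Fintype.card_fin]) (by rw [Fintype.card_fin]; exact hL)
  simp only [Fintype.card_fin] at h1 h2
  rw [← fullFamily_eq_extremal, min_eq_right (by omega), traceWeight, if_pos (by omega),
    show n - (n - 1) = 1 by omega, Nat.choose_self, one_mul, pow_one] at h1
  have h3 : ((k - 1 : ℕ) : ℤ) = (k : ℤ) - 1 := by push_cast [show 1 ≤ k by omega]; ring
  have h4 := congrArg (Nat.cast : ℕ → ℤ) h2
  push_cast at h4
  rw [h3] at h4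
  rw [h1]
  push_cast
  rw [h3]
  linarith

end Families

theorem theorem3p1 (n k r : ℕ) (hr : 3 ≤ r) (hrn : r ≤ n) (hk : 2 ≤ k)
    (F : Finset (Finset (Fin n × Fin k)))
    (hF : F ⊆ rIndepSets n k r)
    (hint : ∀ A ∈ F, ∀ B ∈ F, (A ∩ B).Nonempty)
    (hempty : ∀ v, ∃ A ∈ F, v ∉ A) :
    (r < n →
      F.card ≤ (hmFamily n k r).card ∧
      (4 ≤ r → (F.card = (hmFamily n k r).card ↔ FamilyIso F (hmFamily n k r)))) ∧
    (r = n →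
      (F.card : ℤ) ≤ (k : ℤ) ^ (n - 1) - ((k : ℤ) - 1) ^ (n - 1) + (k : ℤ) - 1 ∧
      (5 ≤ n →
        (FamilyIso F (fullFamily n k) →
          (F.card : ℤ) = (k : ℤ) ^ (n - 1) - ((k : ℤ) - 1) ^ (n - 1) + (k : ℤ) - 1) ∧
        (3 ≤ k →
          (F.card : ℤ) = (k : ℤ) ^ (n - 1) - ((k : ℤ) - 1) ^ (n - 1) + (k : ℤ) - 1 →
          FamilyIso F (fullFamily n k)))) := by
  have hn : 0 < n := by omega
  have h0 : 0 < k := by omega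
  rw [rIndepSets_eq_indSets] at hF
  have hmain := fun {v : Fin n × Fin k} {L} hL => card_le_card_extremal (ι := Fin n)
    (κ := Fin k) ⟨0, h0⟩ hr (by rwa [Fintype.card_fin]) (by rwa [Fintype.card_fin])
    (v := v) (L := L) hL hF hint hempty
  simp only [Fintype.card_fin] at hmain
  constructor
  · intro hlt
    have hL := firstVertices_mem_indSets (n := n) (k := k) hn h0 (show r ≤ n - 1 by omega)
    rw [show r = min r (n - 1) by omega] at hL
    have := hmain (v := (⟨0, hn⟩, ⟨0, h0⟩)) hL
    rw [← show r = min r (n - 1) by omega] at hL this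
    rw [← hmFamily_eq_extremal hn h0 hlt] at this
    refine ⟨this.1, fun hr4 => ⟨fun hcard => ?_, FamilyIso.card_eq⟩⟩
    obtain ⟨v', L', hL', rfl⟩ := this.2 (Or.inl ⟨hr4, hlt⟩) hcard
    rw [hmFamily_eq_extremal hn h0 hlt]
    exact familyIso_extremal hL' hL
  · rintro rfl
    have hL := firstVertices_mem_indSets (n := r) (k := k) hn h0 (le_refl (r - 1))
    have := hmain (v := (⟨0, hn⟩, ⟨0, h0⟩)) (L := firstVertices r k (r - 1))
      (by rwa [min_eq_right (by omega)])
    rw [min_eq_right (by omega), ← fullFamily_eq_extremal hn h0] at this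
    rw [← card_fullFamily hn hk]
    refine ⟨by exact_mod_cast this.1, fun hr5 => ⟨fun h => by rw [h.card_eq], fun hk3 hcard => ?_⟩⟩
    obtain ⟨v', L', hL', rfl⟩ := this.2 (Or.inr ⟨rfl, hr5, hk3⟩) (by exact_mod_cast hcard)
    rw [fullFamily_eq_extremal hn h0]
    exact familyIso_extremal hL' hL
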